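/- Let $\bar S$ be a connected closed oriented surface of genus $g$, let $P\subset\bar S$ be a set of $p\ge 1$ points with $m:=2g-2+p>0$, and let $S=\bar S\setminus P$. An ideal triangulation $\lambda$ of $S$ is a triangulation of $\bar S$ with vertex set exactly $P$ (two sides of the same triangle may be glued together); it has $2m$ triangles and $3m$ edges $\lambda_1,\dots,\lambda_{3m}$. A decorated ideal triangulation $\tau$ with underlying ideal triangulation $\lambda$ is $\lambda$ together with a numbering $\tau_1,\dots,\tau_{2m}$ of its triangles and a marked corner of each triangle. The sides of each triangle are numbered $0,1,2$ in counterclockwise order so that the $0$-side is opposite to the marked corner. Let $\mathcal K_\tau=\mathbb R^{4m}=\{(\ln y_1,\ln z_1,\dots,\ln y_{2m},\ln z_{2m})\}$ be the space of Kashaev coordinates, and put $\ln h_\mu^0=\ln y_\mu-\ln z_\mu$, $\ln h_\mu^1=\ln z_\mu$, $\ln h_\mu^2=-\ln y_\mu$; thus $\ln h^0_\mu+\ln h^1_\mu+\ln h^2_\mu=0$ for every $\mu$. Let $\widetilde{\mathcal T}_\lambda=\mathbb R^{3m}=\{(\ln x_1,\dots,\ln x_{3m})\}$ be the space of shear coordinates.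 Define linear maps as follows. * $f_1:\widetilde{\mathcal T}_\lambda\to\mathbb R$ is $f_1(\ln x_1,\dots,\ln x_{3m})=\sum_{i=1}^{3m}\ln x_i$. * $f_2:\mathcal K_\tau\to\widetilde{\mathcal T}_\lambda$ is given by $\ln x_i=\ln h_\mu^s+\ln h_\nu^t$ whenever $\lambda_i$ bounds the $s$-side of $\tau_\mu$ and the $t$-side of $\tau_\nu$ (possibly $\mu=\nu$). * $f_3:H_1(S,\mathbb R)\to\mathcal K_\tau$. The dual graph of $\lambda$, embedded in $S$, has one vertex inside each triangle and, for each $i$, one edge $\lambda_i^*$ crossing $\lambda_i$ once. Orient its edges arbitrarily. Every class in $H_1(S,\mathbb R)$ (singular homology) is represented by a cycle $\sum_i c_i\lambda_i^*$ of the dual graph, and there is a well-defined linear map $f_3$, independent of the orientations, sending the class of $\sum_i c_i\lambda_i^*$ to the vector with $\ln h_\mu^s=-c_i$ and $\ln h_\nu^t=c_i$ whenever $\lambda_i^*$ runs from the $s$-side of $\tau_\mu$ to the $t$-side of $\tau_\nu$. Then the sequence $$0\longrightarrow H_1(S,\mathbb R)\xrightarrow{\ f_3\ }\mathcal K_\tau\xrightarrow{\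 f_2\ }\widetilde{\mathcal T}_\lambda\xrightarrow{\ f_1\ }\mathbb R\longrightarrow 0$$ is exact. -/

import Mathlib

open CategoryTheory AlgebraicTopology

noncomputable section

namespace Kashaev

/-! ### Gluing oriented triangles -/

/-- The sides of `n` triangles. Side `k` of a triangle is the one opposite to its corner `k`, and
the corners `0, 1, 2` of every triangle are in counterclockwise order; hence so are the sides. -/
abbrev Side (n : ℕ) : Type := Fin n × Fin 3

/-- A point of the disjoint union of `n` closed triangles, in barycentric coordinates. -/
abbrev TrianglePoint (n : ℕ) : Type := Fin n × stdSimplex ℝ (Fin 3)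

/-- `edge s` is the edge of the triangulation bounded by the side `s`. Two distinct sides which
bound the same edge are glued by the affine identification that reverses their boundary
orientations: side `k` runs from corner `k + 1` to corner `k + 2`, side `l` from corner `l + 1`
to corner `l + 2`, and corner `k + 1` is matched with corner `l + 2`, corner `k + 2` with
corner `l + 1` (indices modulo `3`). -/
def Glue {n e : ℕ} (edge : Side n → Fin e) (x y : TrianglePoint n) : Prop :=
  ∃ k l : Fin 3, (x.1, k) ≠ (y.1, l) ∧ edge (x.1, k) = edge (y.1, l) ∧
    x.2 k = 0 ∧ y.2 l = 0 ∧ x.2 (k + 1) = y.2 (l + 2) ∧ x.2 (k + 2) = y.2 (l + 1)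

/-- The space obtained from `n` closed triangles by gluing their sides, with the
quotient topology. -/
def GluedSpace {n e : ℕ} (edge : Side n → Fin e) : Type := Quot (Glue edge)

instance {n e : ℕ} (edge : Side n → Fin e) : TopologicalSpace (GluedSpace edge) :=
  inferInstanceAs (TopologicalSpace (Quot (Glue edge)))

/-- The image of a point of a triangle in the glued space. -/
def GluedSpace.mk {n e : ℕ} (edge : Side n → Fin e) (x : TrianglePoint n) : GluedSpace edge :=
  Quot.mk _ x

theorem GluedSpace.continuous_mk {n e : ℕ} (edge : Side n → Fin e) :
    Continuous (GluedSpace.mk edge) := continuous_quot_mk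

/-- A point of a triangle is a corner if one of its barycentric coordinates is `1`. -/
def IsCorner {n : ℕ} (x : TrianglePoint n) : Prop := ∃ j : Fin 3, x.2 j = 1

theorem Glue.isCorner_iff {n e : ℕ} {edge : Side n → Fin e} {x y : TrianglePoint n}
    (h : Glue edge x y) : IsCorner x ↔ IsCorner y := by
  obtain ⟨k, l, -, -, hx, hy, h1, h2⟩ := h
  have key : ∀ k j : Fin 3, j = k ∨ j = k + 1 ∨ j = k + 2 := by decide
  constructor
  · rintro ⟨j, hj⟩
    rcases key k j with rfl | rfl | rfl
    · rw [hx] at hj; norm_num at hj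
    · exact ⟨l + 2, h1 ▸ hj⟩
    · exact ⟨l + 1, h2 ▸ hj⟩
  · rintro ⟨j, hj⟩
    rcases key l j with rfl | rfl | rfl
    · rw [hy] at hj; norm_num at hj
    · exact ⟨k + 2, h2 ▸ hj⟩
    · exact ⟨k + 1, h1 ▸ hj⟩

/-- The vertices of the glued space: the images of the corners of the triangles. -/
def GluedSpace.vertices {n e : ℕ} (edge : Side n → Fin e) : Set (GluedSpace edge) :=
  GluedSpace.mk edge '' {x | IsCorner x}

theorem GluedSpace.mk_mem_vertices {n e : ℕ} (edge : Side n → Fin e) (x : TrianglePoint n) :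
    GluedSpace.mk edge x ∈ GluedSpace.vertices edge ↔ IsCorner x := by
  refine ⟨?_, fun h => ⟨x, h, rfl⟩⟩
  rintro ⟨y, hy, hyx⟩
  have h : IsCorner y = IsCorner x :=
    congrArg (Quot.lift (IsCorner (n := n)) fun a b h => propext h.isCorner_iff) hyx
  exact h.mp hy

/-! ### Decorated ideal triangulations -/

/-- A decorated ideal triangulation of the punctured surface `X \ P`, where `X` is a closed
oriented surface and `P ⊆ X` is the set of its punctures, with `2m` numbered triangles and `3m`
edges: a presentation of `X` as `2m` oriented triangles glued in pairs along their sides by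
orientation-reversing identifications, such that the vertices are exactly the punctures.
Two sides of the same triangle may be glued together. The marked corner of each triangle is its
corner `0`, so that the sides `0, 1, 2` are in counterclockwise order and the `0`-side is opposite
to the marked corner. The orientation of `X` is the one for which the maps of the triangles
into `X` preserve orientation. -/
structure DecoratedIdealTriangulation (X : Type) [TopologicalSpace X] (P : Set X) (m : ℕ) where
  /-- The edge bounded by a side of a triangle. -/
  edge : Side (2 * m) → Fin (3 * m)
  /-- Every edge bounds exactly two sides. -/
  card_edge : ∀ i, (Finset.univ.filter fun s => edge s = i).card = 2
  /-- The triangulation of the closed surface. -/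
  homeo : GluedSpace edge ≃ₜ X
  /-- The vertices of the triangulation are exactly the punctures. -/
  image_vertices : homeo '' GluedSpace.vertices edge = P

/-- An orientation of all the edges of the dual graph: the dual edge `λᵢ*` starts at the side
`start i` and ends at the side `finish i`, where `start i` and `finish i` are the two sides bounded
by `λᵢ`. The vertices of the dual graph are the triangles. -/
structure DualOrientation {n e : ℕ} (edge : Side n → Fin e) where
  /-- The side at which the dual edge starts. -/
  start : Fin e → Side n
  /-- The side at which the dual edge ends. -/
  finish : Fin e → Side n
  edge_start : ∀ i, edge (start i) = i
  edge_finish : ∀ i, edge (finish i) = i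
  start_ne_finish : ∀ i, start i ≠ finish i

namespace DualOrientation

variable {n e : ℕ} {edge : Side n → Fin e} (ω : DualOrientation edge)

/-- The boundary map of the dual graph: `λᵢ*` is sent to its end vertex minus its
start vertex. -/
def boundary : (Fin e → ℝ) →ₗ[ℝ] (Fin n → ℝ) :=
  Fintype.linearCombination ℝ fun i =>
    (Pi.single (ω.finish i).1 1 - Pi.single (ω.start i).1 1 : Fin n → ℝ)

/-- The `1`-cycles `∑ cᵢ λᵢ*` of the dual graph. -/
abbrev cycles : Submodule ℝ (Fin e → ℝ) := LinearMap.ker ω.boundary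

end DualOrientation

/-! ### The dual graph in the punctured surface -/

/-- The point at time `t` of the segment from the barycenter of a triangle (`t = 0`) to the
midpoint of its side `k` (`t = 1`). -/
def toSide (k : Fin 3) (t : unitInterval) : stdSimplex ℝ (Fin 3) :=
  ⟨fun j => (1 - (t : ℝ)) / 3 + if j = k then 0 else (t : ℝ) / 2, by
    intro j
    have h0 := t.2.1
    have h1 := t.2.2
    dsimp only
    split_ifs <;> linarith, by
    fin_cases k <;> simp [Fin.sum_univ_three] <;> ring⟩

theorem toSide_apply (k : Fin 3) (t : unitInterval) (j : Fin 3) :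
    toSide k t j = (1 - (t : ℝ)) / 3 + if j = k then 0 else (t : ℝ) / 2 := rfl

theorem continuous_toSide (k : Fin 3) : Continuous (toSide k) := by
  refine Continuous.subtype_mk (continuous_pi fun j => ?_) _
  split_ifs <;> fun_prop

theorem not_isCorner_toSide {n : ℕ} (s : Side n) (t : unitInterval) :
    ¬ IsCorner ((s.1, toSide s.2 t) : TrianglePoint n) := by
  rintro ⟨j, hj⟩
  have h0 := t.2.1
  have h1 := t.2.2
  dsimp only at hj
  rw [toSide_apply] at hj
  split_ifs at hj <;> linarith

namespace DecoratedIdealTriangulation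

variable {X : Type} [TopologicalSpace X] {P : Set X} {m : ℕ}
  (T : DecoratedIdealTriangulation X P m)

theorem notMem_of_not_isCorner {x : TrianglePoint (2 * m)} (hx : ¬ IsCorner x) :
    T.homeo (GluedSpace.mk T.edge x) ∉ P := by
  intro hxP
  obtain ⟨q, hq, h⟩ := (Set.ext_iff.mp T.image_vertices _).mpr hxP
  rw [T.homeo.injective h, GluedSpace.mk_mem_vertices] at hq
  exact hx hq

/-- The point of the punctured surface represented by a point of a triangle that is
not a corner. -/
def point (x : TrianglePoint (2 * m)) (hx : ¬ IsCorner x) : (Pᶜ : Set X) :=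
  ⟨T.homeo (GluedSpace.mk T.edge x), T.notMem_of_not_isCorner hx⟩

/-- The vertex of the dual graph dual to the triangle `μ`: its barycenter. -/
def center (μ : Fin (2 * m)) : (Pᶜ : Set X) :=
  T.point (μ, toSide 0 0) (not_isCorner_toSide (μ, 0) 0)

/-- The midpoint of a side. -/
def midpoint (s : Side (2 * m)) : (Pᶜ : Set X) :=
  T.point (s.1, toSide s.2 1) (not_isCorner_toSide s 1)

/-- A half-edge of the dual graph: the segment from the barycenter of a triangle to the midpoint
of one of its sides. -/
def halfEdge (s : Side (2 * m)) : Path (T.center s.1) (T.midpoint s) where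
  toFun t := T.point (s.1, toSide s.2 t) (not_isCorner_toSide s t)
  continuous_toFun := by
    refine Continuous.subtype_mk ?_ _
    exact T.homeo.continuous.comp ((GluedSpace.continuous_mk T.edge).comp
      (continuous_const.prodMk (continuous_toSide s.2)))
  source' := by
    have h : toSide s.2 0 = toSide 0 0 := by
      ext j
      simp [toSide_apply]
    simp [center, h]
  target' := rfl

theorem midpoint_eq {s t : Side (2 * m)} (hst : s ≠ t) (h : T.edge s = T.edge t) :
    T.midpoint s = T.midpoint t := by
  have key : ∀ k : Fin 3, k + 1 ≠ k ∧ k + 2 ≠ k := by decide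
  have : GluedSpace.mk T.edge (s.1, toSide s.2 1) = GluedSpace.mk T.edge (t.1, toSide t.2 1) := by
    refine Quot.sound ⟨s.2, t.2, hst, h, ?_, ?_, ?_, ?_⟩ <;> simp [toSide_apply, key]
  exact Subtype.ext (congrArg T.homeo this)

/-- The oriented dual edge `λᵢ*` as a path in the punctured surface: it starts at the
barycenter of the triangle at its start, crosses the edge `λᵢ` once, at its midpoint, and ends at
the barycenter of the triangle at its end. -/
def dualEdge (ω : DualOrientation T.edge) (i : Fin (3 * m)) :
    Path (T.center (ω.start i).1) (T.center (ω.finish i).1) :=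
  (T.halfEdge (ω.start i)).trans
    ((T.halfEdge (ω.finish i)).symm.cast
      (T.midpoint_eq (ω.start_ne_finish i) ((ω.edge_start i).trans (ω.edge_finish i).symm)) rfl)

end DecoratedIdealTriangulation

/-! ### Singular homology and the homology class of a cycle of the dual graph -/

/-- The first singular homology group `H₁(S; ℝ)`. -/
abbrev H1 (S : Type) [TopologicalSpace S] : ModuleCat ℝ :=
  ((singularHomologyFunctor (ModuleCat ℝ) 1).obj (ModuleCat.of ℝ ℝ)).obj (TopCat.of S)

section

open Simplicial

/-- A path, as a singular `1`-simplex. -/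
def pathSimplex {S : Type} [TopologicalSpace S] {x y : S} (p : Path x y) :
    (TopCat.toSSet.obj (TopCat.of S)) _⦋1⦌ :=
  (TopCat.toSSetObjEquiv (TopCat.of S) _).symm
    ((p : C(unitInterval, S)).comp (toContinuousMap stdSimplexHomeomorphUnitInterval))

/-- A point, as a singular `0`-simplex. -/
def pointSimplex {S : Type} [TopologicalSpace S] (x : S) :
    (TopCat.toSSet.obj (TopCat.of S)) _⦋0⦌ :=
  (TopCat.toSSetObjEquiv (TopCat.of S) _).symm (ContinuousMap.const _ x)

theorem δ_zero_pathSimplex {S : Type} [TopologicalSpace S] {x y : S} (p : Path x y) :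
    (TopCat.toSSet.obj (TopCat.of S)).δ 0 (pathSimplex p) = pointSimplex y := by
  apply (TopCat.toSSetObjEquiv (TopCat.of S) _).injective
  ext z
  obtain rfl : z = stdSimplex.vertex 0 := Subsingleton.elim (α := stdSimplex ℝ (Fin 1)) _ _
  have h : stdSimplexHomeomorphUnitInterval
      (stdSimplex.map (Fin.succAbove 0) (stdSimplex.vertex (0 : Fin 1))) = 1 := by
    rw [stdSimplex.map_vertex]
    rfl
  exact (congrArg p h).trans p.target

theorem δ_one_pathSimplex {S : Type} [TopologicalSpace S] {x y : S} (p : Path x y) :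
    (TopCat.toSSet.obj (TopCat.of S)).δ 1 (pathSimplex p) = pointSimplex x := by
  apply (TopCat.toSSetObjEquiv (TopCat.of S) _).injective
  ext z
  obtain rfl : z = stdSimplex.vertex 0 := Subsingleton.elim (α := stdSimplex ℝ (Fin 1)) _ _
  have h : stdSimplexHomeomorphUnitInterval
      (stdSimplex.map (Fin.succAbove 1) (stdSimplex.vertex (0 : Fin 1))) = 0 := by
    rw [stdSimplex.map_vertex]
    rfl
  exact (congrArg p h).trans p.source

end

/-- The chain complex of singular chains with real coefficients. -/
abbrev singularChains (S : Type) [TopologicalSpace S] : ChainComplex (ModuleCat ℝ) ℕ :=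
  (TopCat.toSSet.obj (TopCat.of S)).chainComplex (ModuleCat.of ℝ ℝ)

namespace DecoratedIdealTriangulation

variable {X : Type} [TopologicalSpace X] {P : Set X} {m : ℕ}
  (T : DecoratedIdealTriangulation X P m)

/-- The singular chain `∑ cᵢ λᵢ*` in the punctured surface, as a linear map of the cycle
`c` of the dual graph. -/
def dualChain (ω : DualOrientation T.edge) :
    ModuleCat.of ℝ ω.cycles ⟶ (singularChains (Pᶜ : Set X)).X 1 :=
  ∑ i, ModuleCat.ofHom (LinearMap.proj i ∘ₗ ω.cycles.subtype) ≫
    SSet.ιChainComplex (R := ModuleCat.of ℝ ℝ) _ (pathSimplex (T.dualEdge ω i))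

theorem dualChain_d (ω : DualOrientation T.edge) :
    T.dualChain ω ≫ (singularChains (Pᶜ : Set X)).d 1 0 = 0 := by
  have hd : ∀ i, SSet.ιChainComplex (R := ModuleCat.of ℝ ℝ) _ (pathSimplex (T.dualEdge ω i)) ≫
      (singularChains (Pᶜ : Set X)).d 1 0 =
      SSet.ιChainComplex (R := ModuleCat.of ℝ ℝ) _ (pointSimplex (T.center (ω.finish i).1)) -
      SSet.ιChainComplex (R := ModuleCat.of ℝ ℝ) _ (pointSimplex (T.center (ω.start i).1)) := by
    intro i
    rw [SSet.ιChainComplex_d, Fin.sum_univ_two, δ_zero_pathSimplex, δ_one_pathSimplex]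
    simp [sub_eq_add_neg]
  let φ : Fin (2 * m) → (ℝ →ₗ[ℝ] (singularChains (Pᶜ : Set X)).X 0) := fun μ =>
    (SSet.ιChainComplex (R := ModuleCat.of ℝ ℝ) _ (pointSimplex (T.center μ))).hom
  have hφ : ∀ μ (r : ℝ), φ μ r = r • φ μ 1 := fun μ r => by
    rw [← map_smul, smul_eq_mul, mul_one]
  rw [dualChain, Preadditive.sum_comp]
  simp only [Category.assoc, hd]
  ext c
  have hc : ω.boundary (c : Fin (3 * m) → ℝ) = 0 := c.2
  rw [DualOrientation.boundary, Fintype.linearCombination_apply] at hc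
  have h1 := congrArg (Fintype.linearCombination ℝ fun μ => φ μ 1) hc
  rw [map_sum, map_zero] at h1
  simp only [map_smul, map_sub, Fintype.linearCombination_apply_single, one_smul] at h1
  rw [ModuleCat.hom_sum, LinearMap.sum_apply]
  refine Eq.trans (Finset.sum_congr rfl fun i _ => ?_) h1
  change φ _ ((c : Fin (3 * m) → ℝ) i) - φ _ ((c : Fin (3 * m) → ℝ) i) = _
  rw [hφ, hφ (ω.start i).1, smul_sub]

/-- The homology class in `H₁(S; ℝ)` of a cycle `∑ cᵢ λᵢ*` of the dual graph, where
`S = X \ P`. -/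
def dualClass (ω : DualOrientation T.edge) : ω.cycles →ₗ[ℝ] H1 (Pᶜ : Set X) :=
  ((singularChains (Pᶜ : Set X)).liftCycles (T.dualChain ω) 0 (by simp) (T.dualChain_d ω) ≫
    (singularChains (Pᶜ : Set X)).homologyπ 1).hom

end DecoratedIdealTriangulation

/-! ### Kashaev coordinates and shear coordinates -/

/-- The space `ℝ^{4m}` of Kashaev coordinates: `v μ = (ln y_μ, ln z_μ)`. -/
abbrev KashaevSpace (m : ℕ) : Type := Fin (2 * m) → ℝ × ℝ

/-- The enhanced Teichmüller space `ℝ^{3m}`, parametrized by the shear coordinates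
`ln x_i`. -/
abbrev ShearSpace (m : ℕ) : Type := Fin (3 * m) → ℝ

/-- The number `ln h_μ^s` associated to the `s`-side of the triangle `μ`: it is
`ln y_μ - ln z_μ` for `s = 0`, `ln z_μ` for `s = 1` and `-ln y_μ` for `s = 2`. -/
def lnH {m : ℕ} : Side (2 * m) → KashaevSpace m →ₗ[ℝ] ℝ
  | (μ, 0) => LinearMap.fst ℝ ℝ ℝ ∘ₗ LinearMap.proj μ - LinearMap.snd ℝ ℝ ℝ ∘ₗ LinearMap.proj μ
  | (μ, 1) => LinearMap.snd ℝ ℝ ℝ ∘ₗ LinearMap.proj μ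
  | (μ, 2) => -(LinearMap.fst ℝ ℝ ℝ ∘ₗ LinearMap.proj μ)

/-- The map `f₂` from Kashaev coordinates to shear coordinates: `ln x_i` is the sum of the
numbers `ln h_μ^s` over the two sides bounded by the edge `i`. -/
def f₂ {X : Type} [TopologicalSpace X] {P : Set X} {m : ℕ}
    (T : DecoratedIdealTriangulation X P m) : KashaevSpace m →ₗ[ℝ] ShearSpace m :=
  LinearMap.pi fun i => ∑ s with T.edge s = i, lnH s

/-- The map `f₁`: the sum of the shear coordinates. -/
def f₁ (m : ℕ) : ShearSpace m →ₗ[ℝ] ℝ := ∑ i, LinearMap.proj i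

end Kashaev

end

/-! Singular homology is handled through its dual. A linear functional on `H1 S` is the same as a
real function of paths that vanishes on the boundary of every singular triangle (a path cocycle), up
to differences `f (γ 1) - f (γ 0)`. Everything needed about the surface is then the construction of
some cocycles and the integration of others.

The map `f₃` exists because the coefficient of a dual edge in a cycle is a homology invariant. The
two sides `s`, `t` of an edge give a map from the surface to the circle which winds once when the
edge is crossed and is trivial along every other dual edge. Its winding cocycle reads off that
coefficient (`exists_winding`, `exists_side_functional`).

The dual graph generates homology because a cocycle that vanishes on all graph cycles has a
potential on the triangles. This extends to the surface by integration from the barycenters, and the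
result is a primitive because every point has an open neighbourhood contracting along segments to
the midpoint of an edge or to a barycenter (`exists_primitive`, `surjective_dualClass`).

The rest is linear algebra. A vector in the kernel of `f₂` puts opposite numbers on the two sides of
each edge, so it is a chain of the dual graph, and the relation `ln h⁰ + ln h¹ + ln h² = 0` in each
triangle says that this chain is a cycle. A functional that kills the range of `f₂` has equal
coefficients on the sides of each triangle, hence on all edges by connectedness, so it is a multiple
of `f₁`. -/

noncomputable section

namespace Kashaev

/-! ### Path cocycles -/

section Segments

variable {E : Type*} [AddCommGroup E] [Module ℝ E] [TopologicalSpace E] [ContinuousAdd E]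
  [ContinuousSMul ℝ E] {C : Set E}

/-- The affine path from `a` to `b` in a convex set. -/
def segmentMap (hC : Convex ℝ C) (a b : C) : C(unitInterval, C) where
  toFun t := ⟨(1 - (t : ℝ)) • (a : E) + (t : ℝ) • (b : E),
    hC a.2 b.2 (sub_nonneg.2 t.2.2) t.2.1 (by ring)⟩
  continuous_toFun := by
    refine Continuous.subtype_mk ?_ _
    fun_prop

/-- The affine map of the standard triangle into a convex set with given vertices. -/
def triangleMap (hC : Convex ℝ C) (a b c : C) : C(stdSimplex ℝ (Fin 3), C) where
  toFun x := ⟨x 0 • (a : E) + x 1 • (b : E) + x 2 • (c : E), by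
    have h := hC.sum_mem (t := Finset.univ) (w := fun i : Fin 3 => x i)
      (z := ![(a : E), b, c]) (fun i _ => x.2.1 i) x.2.2 (by
        intro i _
        fin_cases i
        exacts [a.2, b.2, c.2])
    simpa [Fin.sum_univ_three] using h⟩
  continuous_toFun := by
    refine Continuous.subtype_mk ?_ _
    have h : ∀ i : Fin 3, Continuous fun x : stdSimplex ℝ (Fin 3) => x i := fun i =>
      (continuous_apply i).comp continuous_subtype_val
    exact (((h 0).smul continuous_const).add ((h 1).smul continuous_const)).add
      ((h 2).smul continuous_const)

end Segments

/-- The side opposite to the vertex `j` of the standard triangle, as a path. -/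
def face (j : Fin 3) : C(unitInterval, stdSimplex ℝ (Fin 3)) where
  toFun t := stdSimplex.map j.succAbove (stdSimplexHomeomorphUnitInterval.symm t)
  continuous_toFun := (stdSimplex.continuous_map _).comp (Homeomorph.continuous _)

theorem face_apply (j : Fin 3) (t : unitInterval) (i : Fin 3) :
    face j t i = if j.succAbove 0 = i then 1 - (t : ℝ) else
      if j.succAbove 1 = i then (t : ℝ) else 0 := by
  have h0 : (stdSimplexHomeomorphUnitInterval.symm t) 0 = 1 - (t : ℝ) := rfl
  have h1 : (stdSimplexHomeomorphUnitInterval.symm t) 1 = (t : ℝ) := rfl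
  change stdSimplex.map j.succAbove _ i = _
  rw [stdSimplex.map_coe, FunOnFinite.linearMap_apply_apply, Finset.sum_filter,
    Fin.sum_univ_two, h0, h1]
  fin_cases j <;> fin_cases i <;> simp [Fin.succAbove]

/-- A real-valued function of the paths in a space which vanishes on the boundaries of all
singular triangles. -/
def IsPathCocycle {S : Type*} [TopologicalSpace S] (A : C(unitInterval, S) → ℝ) : Prop :=
  ∀ h : C(stdSimplex ℝ (Fin 3), S), A (h.comp (face 0)) - A (h.comp (face 1)) +
    A (h.comp (face 2)) = 0

theorem triangleMap_comp_face {E : Type*} [AddCommGroup E] [Module ℝ E] [TopologicalSpace E]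
    [ContinuousAdd E] [ContinuousSMul ℝ E] {C : Set E} (hC : Convex ℝ C) (p : Fin 3 → C)
    (j : Fin 3) : (triangleMap hC (p 0) (p 1) (p 2)).comp (face j) =
      segmentMap hC (p (j.succAbove 0)) (p (j.succAbove 1)) := by
  ext t
  change face j t 0 • (p 0 : E) + face j t 1 • (p 1 : E) + face j t 2 • (p 2 : E) =
    (1 - (t : ℝ)) • (p (j.succAbove 0) : E) + (t : ℝ) • (p (j.succAbove 1) : E)
  simp only [face_apply]
  fin_cases j <;> simp [Fin.succAbove]

namespace IsPathCocycle

variable {S : Type*} [TopologicalSpace S] {A : C(unitInterval, S) → ℝ}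

/-- The three segments are the faces of one affine triangle, degenerate ones included. This is the
only way the cocycle condition enters the path calculus below. -/
theorem segment_add {E : Type*} [AddCommGroup E] [Module ℝ E] [TopologicalSpace E]
    [ContinuousAdd E] [ContinuousSMul ℝ E] {C : Set E} (hA : IsPathCocycle A) (hC : Convex ℝ C)
    (F : C(C, S)) (a b c : C) : A (F.comp (segmentMap hC a b)) + A (F.comp (segmentMap hC b c)) =
      A (F.comp (segmentMap hC a c)) := by
  have h := hA (F.comp (triangleMap hC a b c))
  have hf := triangleMap_comp_face hC ![a, b, c]
  have h0 := hf 0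
  have h1 := hf 1
  have h2 := hf 2
  simp only [Matrix.cons_val, Fin.succAbove] at h0 h1 h2
  simp [ContinuousMap.comp_assoc, h0, h1, h2] at h
  linarith

/-- On a constant triangle all three faces are the same path, so the alternating sum is a single
value of `A`. -/
theorem const (hA : IsPathCocycle A) (x : S) : A (ContinuousMap.const _ x) = 0 := by
  have h := hA (ContinuousMap.const _ x)
  simpa only [ContinuousMap.const_comp, sub_self, zero_add] using h

theorem subsegment_add (hA : IsPathCocycle A) (γ : C(unitInterval, S)) (a b c : unitInterval) :
    A (γ.comp (segmentMap (convex_Icc 0 1) a b)) + A (γ.comp (segmentMap (convex_Icc 0 1) b c)) =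
      A (γ.comp (segmentMap (convex_Icc 0 1) a c)) :=
  hA.segment_add (convex_Icc 0 1) γ a b c

theorem trans (hA : IsPathCocycle A) {x y z : S} (p : Path x y) (q : Path y z) :
    A (p.trans q) = A p + A q := by
  have h := hA.subsegment_add (p.trans q : C(unitInterval, S)) 0 ⟨1 / 2, by norm_num, by norm_num⟩ 1
  have h1 : (p.trans q : C(unitInterval, S)).comp
      (segmentMap (convex_Icc 0 1) 0 ⟨1 / 2, by norm_num, by norm_num⟩) = p := by
    ext t
    have hu : (segmentMap (convex_Icc (0 : ℝ) 1) 0 ⟨1 / 2, by norm_num, by norm_num⟩ t : ℝ) =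
        t / 2 := by
      simp [segmentMap, div_eq_mul_inv]
    refine (Path.trans_apply p q _).trans ?_
    rw [dif_pos (by linarith [t.2.2])]
    exact congrArg p (Subtype.ext (by linarith))
  have h2 : (p.trans q : C(unitInterval, S)).comp
      (segmentMap (convex_Icc 0 1) ⟨1 / 2, by norm_num, by norm_num⟩ 1) = q := by
    ext t
    have hu : (segmentMap (convex_Icc (0 : ℝ) 1) ⟨1 / 2, by norm_num, by norm_num⟩ 1 t : ℝ) =
        (1 + t) / 2 := by
      simp [segmentMap]
      ring
    refine (Path.trans_apply p q _).trans ?_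
    split_ifs with h
    -- At `t = 0` the parameter is exactly `1 / 2`, which the concatenation assigns to `p`; the
    -- endpoints of `p` and `q` agree there.
    · have ht : t = 0 := Subtype.ext (le_antisymm (show (t : ℝ) ≤ 0 by linarith) t.2.1)
      subst ht
      have h0 : ((0 : unitInterval) : ℝ) = 0 := rfl
      refine (congrArg p (Subtype.ext ?_)).trans (p.target.trans q.source.symm)
      change 2 * (segmentMap (convex_Icc (0 : ℝ) 1) _ _ _ : ℝ) = 1
      linarith
    · exact congrArg q (Subtype.ext (by linarith))
  have h3 : (p.trans q : C(unitInterval, S)).comp (segmentMap (convex_Icc 0 1) 0 1) =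
      p.trans q := by
    ext t
    exact congrArg (p.trans q) (Subtype.ext (by simp [segmentMap]))
  rw [h1, h2, h3] at h
  exact h.symm

theorem symm (hA : IsPathCocycle A) {x y : S} (p : Path x y) : A p.symm = - A p := by
  have h := hA.subsegment_add (p : C(unitInterval, S)) 0 1 0
  have h1 : (p : C(unitInterval, S)).comp (segmentMap (convex_Icc 0 1) 0 1) = p := by
    ext t
    exact congrArg p (Subtype.ext (by simp [segmentMap]))
  have h2 : (p : C(unitInterval, S)).comp (segmentMap (convex_Icc 0 1) 1 0) = p.symm := by
    ext t
    exact congrArg p (Subtype.ext (by simp [segmentMap]))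
  have h3 : (p : C(unitInterval, S)).comp (segmentMap (convex_Icc 0 1) 0 0) =
      ContinuousMap.const _ x := by
    ext t
    exact (congrArg p (Subtype.ext (by simp [segmentMap]))).trans p.source
  rw [h1, h2, h3, hA.const] at h
  linarith

/-- The values of a path cocycle on the four sides of a square. -/
theorem square (hA : IsPathCocycle A) (K : C(unitInterval × unitInterval, S)) :
    A (K.comp (.prodMk (.id _) (.const _ 0))) + A (K.comp (.prodMk (.const _ 1) (.id _))) =
      A (K.comp (.prodMk (.const _ 0) (.id _))) + A (K.comp (.prodMk (.id _) (.const _ 1))) := by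
  have hC : Convex ℝ (Set.Icc (0 : ℝ) 1 ×ˢ Set.Icc (0 : ℝ) 1) :=
    (convex_Icc 0 1).prod (convex_Icc 0 1)
  let F : C((Set.Icc (0 : ℝ) 1 ×ˢ Set.Icc (0 : ℝ) 1 : Set (ℝ × ℝ)), S) :=
    ⟨fun x => K (⟨x.1.1, x.2.1⟩, ⟨x.1.2, x.2.2⟩), by fun_prop⟩
  let p : unitInterval → unitInterval → (Set.Icc (0 : ℝ) 1 ×ˢ Set.Icc (0 : ℝ) 1 : Set (ℝ × ℝ)) :=
    fun s t => ⟨(s, t), s.2, t.2⟩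
  -- Both routes around the square have the value of the diagonal.
  have h := (hA.segment_add hC F (p 0 0) (p 1 0) (p 1 1)).trans
    (hA.segment_add hC F (p 0 0) (p 0 1) (p 1 1)).symm
  convert h using 3 <;>
  · ext t
    exact congrArg K (Prod.ext (Subtype.ext (by simp [segmentMap, p]))
      (Subtype.ext (by simp [segmentMap, p])))

end IsPathCocycle

/-! ### Winding numbers -/

/-- Every map of a convex set to the circle lifts to the real line. -/
theorem exists_lift_addCircle {E : Type*} [AddCommGroup E] [Module ℝ E] [TopologicalSpace E]
    [IsTopologicalAddGroup E] [ContinuousSMul ℝ E] [LocallyConvexSpace ℝ E] {C : Set E}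
    (hC : Convex ℝ C) (hne : C.Nonempty) (f : C(C, AddCircle (1 : ℝ))) :
    ∃ F : C(C, ℝ), ∀ x, (F x : AddCircle (1 : ℝ)) = f x := by
  have := hC.contractibleSpace hne
  have := hC.locallyPathConnectedSpace
  obtain ⟨a, ha⟩ := hne
  obtain ⟨e, he⟩ := QuotientAddGroup.mk_surjective (f ⟨a, ha⟩)
  obtain ⟨F, ⟨-, hF⟩, -⟩ := (AddCircle.isCoveringMap_coe (1 : ℝ)).existsUnique_continuousMap_lifts
    f ⟨a, ha⟩ e he
  exact ⟨F, congrFun hF⟩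

section Winding

variable {S : Type*} [TopologicalSpace S] (q : C(S, AddCircle (1 : ℝ)))

/-- The total variation along a path of a continuous lift to `ℝ` of a circle-valued function. -/
def winding (γ : C(unitInterval, S)) : ℝ :=
  let F := (exists_lift_addCircle (convex_Icc 0 1) ⟨0, by simp⟩ (q.comp γ)).choose
  F (1 : unitInterval) - F (0 : unitInterval)

/-- Two lifts of the same path differ by a constant, so the choice in `winding` is immaterial: once
translated to agree at `0`, they coincide by uniqueness of lifts. -/
theorem winding_eq {γ : C(unitInterval, S)} (F : C(unitInterval, ℝ))
    (hF : ∀ t, (F t : AddCircle (1 : ℝ)) = q (γ t)) : winding q γ = F 1 - F 0 := by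
  have hG := (exists_lift_addCircle (convex_Icc 0 1) ⟨0, by simp⟩ (q.comp γ)).choose_spec
  set G := (exists_lift_addCircle (convex_Icc 0 1) ⟨0, by simp⟩ (q.comp γ)).choose
  change G (1 : unitInterval) - G (0 : unitInterval) = _
  have h := (AddCircle.isCoveringMap_coe (1 : ℝ)).eq_of_comp_eq (A := unitInterval)
    (g₁ := fun t => G t + (F 0 - G (0 : unitInterval))) (g₂ := F) (by fun_prop) (by fun_prop) ?_ 0
    (by simp)
  · have := congrFun h 1
    linarith
  · ext t
    have h0 : ((F 0 : ℝ) : AddCircle (1 : ℝ)) = (G (0 : unitInterval) : ℝ) :=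
      (hF 0).trans (hG 0).symm
    change ((G t + (F 0 - G (0 : unitInterval)) : ℝ) : AddCircle (1 : ℝ)) = (F t : ℝ)
    rw [AddCircle.coe_add, AddCircle.coe_sub, h0, sub_self, add_zero, hF]
    exact hG t

/-- One lift over the whole triangle computes all three faces, and its differences at the vertices
cancel. -/
theorem isPathCocycle_winding : IsPathCocycle (winding q) := by
  intro h
  obtain ⟨F, hF⟩ := exists_lift_addCircle (convex_stdSimplex ℝ (Fin 3))
    Set.Nonempty.of_subtype (q.comp h)
  have key : ∀ j, winding q (h.comp (face j)) = F (face j 1) - F (face j 0) := fun j =>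
    winding_eq q (F.comp (face j)) fun t => hF _
  have h1 : face 0 1 = face 1 1 := by
    ext i; simp only [face_apply]; fin_cases i <;> simp [Fin.succAbove]
  have h2 : face 0 0 = face 2 1 := by
    ext i; simp only [face_apply]; fin_cases i <;> simp [Fin.succAbove]
  have h3 : face 1 0 = face 2 0 := by
    ext i; simp only [face_apply]; fin_cases i <;> simp [Fin.succAbove]
  rw [key, key, key, h1, h2, h3]
  ring

end Winding

/-! ### Path cocycles and singular homology -/

section Homology

open Simplicial

variable {S : Type} [TopologicalSpace S]

/-- The path underlying a singular `1`-simplex. -/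
def simplexPath (x : (TopCat.toSSet.obj (TopCat.of S)) _⦋1⦌) : C(unitInterval, S) :=
  (TopCat.toSSetObjEquiv (TopCat.of S) _ x).comp
    (toContinuousMap stdSimplexHomeomorphUnitInterval.symm)

/-- A continuous map of the unit interval, as a singular `1`-simplex. -/
def mapSimplex (γ : C(unitInterval, S)) : (TopCat.toSSet.obj (TopCat.of S)) _⦋1⦌ :=
  (TopCat.toSSetObjEquiv (TopCat.of S) _).symm
    (γ.comp (toContinuousMap stdSimplexHomeomorphUnitInterval))

theorem simplexPath_mapSimplex (γ : C(unitInterval, S)) : simplexPath (mapSimplex γ) = γ := by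
  ext t
  exact congrArg γ (stdSimplexHomeomorphUnitInterval.apply_symm_apply t)

theorem mapSimplex_simplexPath (x : (TopCat.toSSet.obj (TopCat.of S)) _⦋1⦌) :
    mapSimplex (simplexPath x) = x := by
  apply (TopCat.toSSetObjEquiv (TopCat.of S) _).injective
  ext z
  exact congrArg (TopCat.toSSetObjEquiv (TopCat.of S) _ x)
    (stdSimplexHomeomorphUnitInterval.symm_apply_apply z)

theorem simplexPath_pathSimplex {x y : S} (p : Path x y) : simplexPath (pathSimplex p) = p :=
  simplexPath_mapSimplex _

theorem simplexPath_δ (x : (TopCat.toSSet.obj (TopCat.of S)) _⦋2⦌) (j : Fin 3) :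
    simplexPath ((TopCat.toSSet.obj (TopCat.of S)).δ j x) =
      (TopCat.toSSetObjEquiv (TopCat.of S) _ x).comp (face j) := by
  ext t
  rfl

theorem mapSimplex_comp_face (h : C(stdSimplex ℝ (Fin 3), S)) (j : Fin 3) :
    mapSimplex (h.comp (face j)) = (TopCat.toSSet.obj (TopCat.of S)).δ j
      ((TopCat.toSSetObjEquiv (TopCat.of S) _).symm h) := by
  rw [← mapSimplex_simplexPath ((TopCat.toSSet.obj (TopCat.of S)).δ j _), simplexPath_δ]
  rfl

/-- The cochain defined by a function of the singular `1`-simplices. -/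
def pathCochain (A : C(unitInterval, S) → ℝ) : (singularChains S).X 1 ⟶ ModuleCat.of ℝ ℝ :=
  ((TopCat.toSSet.obj (TopCat.of S)).isColimitChainComplexXCofan (ModuleCat.of ℝ ℝ) 1).desc
    (Limits.Cofan.mk _ fun x => A (simplexPath x) • 𝟙 (ModuleCat.of ℝ ℝ))

theorem ι_pathCochain (A : C(unitInterval, S) → ℝ)
    (x : (TopCat.toSSet.obj (TopCat.of S)) _⦋1⦌) :
    SSet.ιChainComplex (R := ModuleCat.of ℝ ℝ) _ x ≫ pathCochain A =
      A (simplexPath x) • 𝟙 (ModuleCat.of ℝ ℝ) :=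
  ((TopCat.toSSet.obj (TopCat.of S)).isColimitChainComplexXCofan (ModuleCat.of ℝ ℝ) 1).fac _ ⟨x⟩

theorem IsPathCocycle.d_pathCochain {A : C(unitInterval, S) → ℝ} (hA : IsPathCocycle A) :
    (singularChains S).d 2 1 ≫ pathCochain A = 0 := by
  refine SSet.chainComplex_hom_ext fun x => ?_
  rw [SSet.ιChainComplex_d_assoc, Fin.sum_univ_three]
  simp only [Preadditive.add_comp, Preadditive.zsmul_comp, ι_pathCochain, simplexPath_δ]
  have h := congrArg (fun r : ℝ => r • 𝟙 (ModuleCat.of ℝ ℝ))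
    (hA (TopCat.toSSetObjEquiv (TopCat.of S) _ x))
  simpa [add_smul, sub_smul, sub_eq_add_neg] using h

/-- The morphism from `H₁(S; ℝ)` to `ℝ` defined by a path cocycle. -/
def IsPathCocycle.evalHom {A : C(unitInterval, S) → ℝ} (hA : IsPathCocycle A) :
    (singularChains S).homology 1 ⟶ ModuleCat.of ℝ ℝ :=
  (singularChains S).homologyι 1 ≫
    (singularChains S).descOpcycles (pathCochain A) 2 (by simp) hA.d_pathCochain

theorem IsPathCocycle.π_evalHom {A : C(unitInterval, S) → ℝ} (hA : IsPathCocycle A) :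
    (singularChains S).homologyπ 1 ≫ hA.evalHom = (singularChains S).iCycles 1 ≫ pathCochain A := by
  rw [IsPathCocycle.evalHom, HomologicalComplex.homology_π_ι_assoc,
    HomologicalComplex.p_descOpcycles]

/-- The linear functional on `H₁(S; ℝ)` defined by a path cocycle. -/
def IsPathCocycle.eval {A : C(unitInterval, S) → ℝ} (hA : IsPathCocycle A) : H1 S →ₗ[ℝ] ℝ :=
  hA.evalHom.hom

/-- A linear functional on `H₁(S; ℝ)` comes from a path cocycle. -/
theorem exists_evalHom_eq (l : (singularChains S).homology 1 ⟶ ModuleCat.of ℝ ℝ) :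
    ∃ A : C(unitInterval, S) → ℝ, ∃ hA : IsPathCocycle A, hA.evalHom = l := by
  -- Over a field the inclusion of the cycles into the chains splits, so a functional on cycles
  -- extends to all chains; `A` then records the values of the extension on single paths.
  obtain ⟨g, hg⟩ := LinearMap.exists_leftInverse_of_injective
    ((singularChains S).iCycles 1).hom
    (LinearMap.ker_eq_bot.2 ((ModuleCat.mono_iff_injective _).1 inferInstance))
  let r : (singularChains S).X 1 ⟶ (singularChains S).cycles 1 := ModuleCat.ofHom g
  let α : (singularChains S).X 1 ⟶ ModuleCat.of ℝ ℝ := r ≫ (singularChains S).homologyπ 1 ≫ l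
  have hα : (singularChains S).iCycles 1 ≫ α =
      (singularChains S).homologyπ 1 ≫ l := by
    have : (singularChains S).iCycles 1 ≫ r = 𝟙 _ := by
      ext1
      exact hg
    rw [reassoc_of% this]
  have hd : (singularChains S).d 2 1 ≫ α = 0 := by
    rw [← HomologicalComplex.toCycles_i_assoc, hα,
      HomologicalComplex.toCycles_comp_homologyπ_assoc, Limits.zero_comp]
  let A : C(unitInterval, S) → ℝ := fun γ =>
    (SSet.ιChainComplex (R := ModuleCat.of ℝ ℝ) _ (mapSimplex γ) ≫ α).hom (1 : ℝ)
  have hA : IsPathCocycle A := by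
    intro h
    have h1 := SSet.ιChainComplex_d_assoc (R := ModuleCat.of ℝ ℝ) _
      ((TopCat.toSSetObjEquiv (TopCat.of S) (.op ⦋2⦌)).symm h) α
    rw [hd, Limits.comp_zero, Fin.sum_univ_three] at h1
    have h2 := congrArg (fun f => f.hom (1 : ℝ)) h1
    simp only [A, mapSimplex_comp_face]
    simp [Preadditive.add_comp] at h2 ⊢
    linarith
  have hAα : pathCochain A = α := by
    refine SSet.chainComplex_hom_ext fun x => ?_
    rw [ι_pathCochain]
    ext
    simp [A, mapSimplex_simplexPath]
  refine ⟨A, hA, ?_⟩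
  rw [← cancel_epi ((singularChains S).homologyπ 1), hA.π_evalHom, hAα, hα]

/-- The functional defined by a coboundary is zero. -/
theorem IsPathCocycle.eval_eq_zero {A : C(unitInterval, S) → ℝ} (hA : IsPathCocycle A)
    (f : S → ℝ) (hf : ∀ γ, A γ = f (γ 1) - f (γ 0)) : hA.eval = 0 := by
  let β : (singularChains S).X 0 ⟶ ModuleCat.of ℝ ℝ :=
    ((TopCat.toSSet.obj (TopCat.of S)).isColimitChainComplexXCofan (ModuleCat.of ℝ ℝ) 0).desc
      (Limits.Cofan.mk _ fun x => f (TopCat.toSSetObjEquiv (TopCat.of S) _ x (stdSimplex.vertex 0))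
        • 𝟙 (ModuleCat.of ℝ ℝ))
  have hβ : ∀ x, SSet.ιChainComplex (R := ModuleCat.of ℝ ℝ) _ x ≫ β =
      f (TopCat.toSSetObjEquiv (TopCat.of S) _ x (stdSimplex.vertex 0)) • 𝟙 (ModuleCat.of ℝ ℝ) :=
    fun x => ((TopCat.toSSet.obj (TopCat.of S)).isColimitChainComplexXCofan
      (ModuleCat.of ℝ ℝ) 0).fac _ ⟨x⟩
  have hAβ : pathCochain A = (singularChains S).d 1 0 ≫ β := by
    refine SSet.chainComplex_hom_ext fun x => ?_
    obtain ⟨γ, rfl⟩ : ∃ γ, x = mapSimplex γ := ⟨_, (mapSimplex_simplexPath x).symm⟩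
    let p : Path (γ 0) (γ 1) := ⟨γ, rfl, rfl⟩
    have hp : mapSimplex γ = pathSimplex p := rfl
    rw [SSet.ιChainComplex_d_assoc, Fin.sum_univ_two, ι_pathCochain, hp, δ_zero_pathSimplex,
      δ_one_pathSimplex, simplexPath_pathSimplex, hf]
    simp only [Preadditive.add_comp, Preadditive.zsmul_comp, hβ]
    rw [sub_smul]
    simp [pointSimplex, sub_eq_add_neg]
  have h : hA.evalHom = 0 := by
    rw [← cancel_epi ((singularChains S).homologyπ 1), hA.π_evalHom, hAβ,
      HomologicalComplex.iCycles_d_assoc, Limits.zero_comp, Limits.comp_zero]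
  rw [IsPathCocycle.eval, h]
  rfl

/-- Every linear functional on `H₁(S; ℝ)` is defined by a path cocycle. -/
theorem exists_eval_eq (l : H1 S →ₗ[ℝ] ℝ) :
    ∃ A : C(unitInterval, S) → ℝ, ∃ hA : IsPathCocycle A, hA.eval = l := by
  let l' : (singularChains S).homology 1 ⟶ ModuleCat.of ℝ ℝ :=
    ModuleCat.ofHom (X := (singularChains S).homology 1) l
  obtain ⟨A, hA, h⟩ := exists_evalHom_eq (S := S) l'
  exact ⟨A, hA, congrArg ModuleCat.Hom.hom h⟩

end Homology

namespace DecoratedIdealTriangulation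

variable {X : Type} [TopologicalSpace X] {P : Set X} {m : ℕ}
  (T : DecoratedIdealTriangulation X P m)

theorem eval_dualClass {A : C(unitInterval, (Pᶜ : Set X)) → ℝ} (hA : IsPathCocycle A)
    (ω : DualOrientation T.edge) (c : ω.cycles) :
    hA.eval (T.dualClass ω c) = ∑ i, (c : Fin (3 * m) → ℝ) i * A (T.dualEdge ω i) := by
  have h : ((singularChains (Pᶜ : Set X)).liftCycles (T.dualChain ω) 0 (by simp)
      (T.dualChain_d ω) ≫ (singularChains (Pᶜ : Set X)).homologyπ 1) ≫ hA.evalHom =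
      T.dualChain ω ≫ pathCochain A := by
    rw [Category.assoc, hA.π_evalHom, HomologicalComplex.liftCycles_i_assoc]
  refine (congrArg (fun f => f.hom c) h).trans ?_
  rw [dualChain, Preadditive.sum_comp]
  simp only [Category.assoc, ι_pathCochain, simplexPath_pathSimplex]
  rw [ModuleCat.hom_sum, LinearMap.sum_apply]
  refine Finset.sum_congr rfl fun i _ => ?_
  simp [mul_comm]

/-! ### Sides and dual edges -/

theorem filter_edge_eq (ω : DualOrientation T.edge) (i : Fin (3 * m)) :
    (Finset.univ.filter fun s => T.edge s = i) = {ω.start i, ω.finish i} := by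
  symm
  apply Finset.eq_of_subset_of_card_le
  · intro s hs
    rw [Finset.mem_insert, Finset.mem_singleton] at hs
    rcases hs with rfl | rfl
    · simp [ω.edge_start]
    · simp [ω.edge_finish]
  · rw [T.card_edge, Finset.card_pair (ω.start_ne_finish i)]

theorem eq_start_or_finish (ω : DualOrientation T.edge) (s : Side (2 * m)) :
    s = ω.start (T.edge s) ∨ s = ω.finish (T.edge s) := by
  have h : s ∈ (Finset.univ.filter fun r => T.edge r = T.edge s) := by simp
  simpa [T.filter_edge_eq ω] using h

theorem sum_sides {M : Type*} [AddCommMonoid M] (ω : DualOrientation T.edge)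
    (g : Side (2 * m) → M) : ∑ s, g s = ∑ i, (g (ω.start i) + g (ω.finish i)) := by
  rw [← Finset.sum_fiberwise Finset.univ T.edge g]
  refine Finset.sum_congr rfl fun i _ => ?_
  rw [T.filter_edge_eq ω, Finset.sum_pair (ω.start_ne_finish i)]

theorem exists_opposite (s : Side (2 * m)) : ∃ t, t ≠ s ∧ T.edge t = T.edge s := by
  have h : 1 < (Finset.univ.filter fun r => T.edge r = T.edge s).card := by
    rw [T.card_edge]
    norm_num
  obtain ⟨t, ht, hts⟩ := Finset.exists_mem_ne h s
  exact ⟨t, hts, by simpa using ht⟩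

theorem opposite_unique {s t r : Side (2 * m)} (ht : t ≠ s) (hr : r ≠ s)
    (hts : T.edge t = T.edge s) (hrs : T.edge r = T.edge s) : t = r := by
  by_contra htr
  have h : ({s, t, r} : Finset (Side (2 * m))) ⊆
      Finset.univ.filter fun r => T.edge r = T.edge s := by
    intro x hx
    simp only [Finset.mem_insert, Finset.mem_singleton] at hx
    rcases hx with rfl | rfl | rfl <;> simp [*]
  have h1 := Finset.card_le_card h
  rw [T.card_edge, Finset.card_eq_three.2 ⟨s, t, r, ht.symm, hr.symm, htr, rfl⟩] at h1
  omega

/-- Every triangulation has an orientation of its dual edges. -/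
theorem nonempty_dualOrientation : Nonempty (DualOrientation T.edge) := by
  have h : ∀ i, ∃ s t : Side (2 * m), T.edge s = i ∧ T.edge t = i ∧ s ≠ t := by
    intro i
    obtain ⟨s, t, hst, h⟩ := Finset.card_eq_two.1 (T.card_edge i)
    have hs : s ∈ Finset.univ.filter fun r => T.edge r = i := by simp [h]
    have ht : t ∈ Finset.univ.filter fun r => T.edge r = i := by simp [h]
    exact ⟨s, t, by simpa using hs, by simpa using ht, hst⟩
  choose s t hs ht hst using h
  exact ⟨⟨s, t, hs, ht, hst⟩⟩

/-! ### The punctured surface as a quotient of triangles without corners -/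

theorem isOpen_not_isCorner {n : ℕ} : IsOpen {x : TrianglePoint n | ¬ IsCorner x} := by
  have h : IsClosed {x : TrianglePoint n | IsCorner x} := by
    have : {x : TrianglePoint n | IsCorner x} = ⋃ j : Fin 3, {x | x.2 j = 1} := by
      ext x
      simp [IsCorner]
    rw [this]
    refine isClosed_iUnion_of_finite fun j => isClosed_eq ?_ continuous_const
    exact (continuous_apply j).comp (continuous_subtype_val.comp continuous_snd)
  exact h.isOpen_compl

/-- The projection of the triangles without their corners onto the punctured surface. -/
def proj (x : {x : TrianglePoint (2 * m) // ¬ IsCorner x}) : (Pᶜ : Set X) := T.point x.1 x.2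

/-- A quotient map remains one over an open subset of its target. The complement of `P` is open
because its preimage, the set of points that are not corners, is open. -/
theorem isQuotientMap_proj : Topology.IsQuotientMap T.proj := by
  have hq : Topology.IsQuotientMap fun x => T.homeo (GluedSpace.mk T.edge x) :=
    T.homeo.isQuotientMap.comp isQuotientMap_quot_mk
  have hpre : {x | ¬ IsCorner x} = (fun x => T.homeo (GluedSpace.mk T.edge x)) ⁻¹' Pᶜ := by
    ext x
    refine ⟨fun hx => T.notMem_of_not_isCorner hx, fun hx hc => hx ?_⟩
    exact T.image_vertices.subset ⟨_, (GluedSpace.mk_mem_vertices _ _).2 hc, rfl⟩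
  have hP : IsOpen Pᶜ := by
    rw [← hq.isOpen_preimage, ← hpre]
    exact isOpen_not_isCorner
  exact (hq.restrictPreimage_isOpen hP).comp (Homeomorph.setCongr hpre).isQuotientMap

/-- A function compatible with the gluing is constant on the fibers of the projection. -/
theorem eq_of_proj_eq {Y : Type*} {F : {x : TrianglePoint (2 * m) // ¬ IsCorner x} → Y}
    (hF : ∀ x y, Glue T.edge x.1 y.1 → F x = F y)
    {x y : {x : TrianglePoint (2 * m) // ¬ IsCorner x}} (h : T.proj x = T.proj y) : F x = F y := by
  classical
  -- Gluing matches corners with corners, so extending by `none` at the corners gives a function on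
  -- all points that respects `Glue`. It factors through `Quot`, which takes care of the generated
  -- equivalence relation.
  let G : TrianglePoint (2 * m) → Option Y := fun x =>
    if hx : ¬ IsCorner x then some (F ⟨x, hx⟩) else none
  have hG : ∀ x y, Glue T.edge x y → G x = G y := by
    intro x y hxy
    by_cases hx : IsCorner x
    · simp [G, hx, hxy.isCorner_iff.1 hx]
    · have hy : ¬ IsCorner y := fun hy => hx (hxy.isCorner_iff.2 hy)
      simp only [G, dif_pos hx, dif_pos hy]
      exact congrArg some (hF ⟨x, hx⟩ ⟨y, hy⟩ hxy)
  have h1 : GluedSpace.mk T.edge x.1 = GluedSpace.mk T.edge y.1 :=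
    T.homeo.injective (congrArg Subtype.val h)
  have h2 : G x.1 = G y.1 := congrArg (Quot.lift G hG) h1
  simpa only [G, dif_pos x.2, dif_pos y.2, Option.some.injEq] using h2

theorem proj_eq_of_glue {x y : {x : TrianglePoint (2 * m) // ¬ IsCorner x}}
    (h : Glue T.edge x.1 y.1) : T.proj x = T.proj y :=
  Subtype.ext (congrArg T.homeo (Quot.sound h))

theorem exists_descend {Y : Type*} [TopologicalSpace Y]
    {F : {x : TrianglePoint (2 * m) // ¬ IsCorner x} → Y} (hc : Continuous F)
    (hF : ∀ x y, Glue T.edge x.1 y.1 → F x = F y) :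
    ∃ G : C((Pᶜ : Set X), Y), ∀ x, G (T.proj x) = F x := by
  have hq : Topology.IsQuotientMap (⟨T.proj, T.isQuotientMap_proj.continuous⟩ : C(_, _)) :=
    T.isQuotientMap_proj
  have hf : Function.FactorsThrough (⟨F, hc⟩ : C(_, Y))
      (⟨T.proj, T.isQuotientMap_proj.continuous⟩ : C(_, _)) :=
    fun x y h => T.eq_of_proj_eq hF h
  exact ⟨hq.lift ⟨F, hc⟩ hf, fun x => congrArg (fun f => f x) (hq.lift_comp ⟨F, hc⟩ hf)⟩

/-! ### Winding around a dual edge -/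

theorem apply_dualEdge {A : C(unitInterval, (Pᶜ : Set X)) → ℝ} (hA : IsPathCocycle A)
    (ω : DualOrientation T.edge) (i : Fin (3 * m)) : A (T.dualEdge ω i) =
      A (T.halfEdge (ω.start i)) - A (T.halfEdge (ω.finish i)) := by
  rw [DecoratedIdealTriangulation.dualEdge, hA.trans, sub_eq_add_neg, ← hA.symm]
  rfl

end DecoratedIdealTriangulation

/-- A function on the triangle without its corners which is `1 / 2` on the side `k` and
vanishes on the other sides and at the barycenter. -/
def sideBump (k : Fin 3) (x : Fin 3 → ℝ) : ℝ :=
  max 0 (x (k + 1) * x (k + 2) / (x 0 * x 1 + x 1 * x 2 + x 2 * x 0) - 1 / 2)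

/-- If the sum were not positive, every coordinate would satisfy `x j * (1 - x j) = 0`, hence
vanish, although the coordinates sum to `1`. The denominator in `sideBump` is thus nonzero off the
corners. Corners must be excluded: the values `1 / 2` and `0` on adjacent sides clash there. -/
theorem sum_mul_pos {x : stdSimplex ℝ (Fin 3)} (hx : ∀ j, x j ≠ 1) :
    0 < x 0 * x 1 + x 1 * x 2 + x 2 * x 0 := by
  have h0 := x.2.1
  have h1 : x 0 + x 1 + x 2 = 1 := by
    rw [← Fin.sum_univ_three]
    exact x.2.2
  have hn : ∀ j, 0 ≤ x j := h0
  have h01 := mul_nonneg (hn 0) (hn 1)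
  have h12 := mul_nonneg (hn 1) (hn 2)
  have h20 := mul_nonneg (hn 2) (hn 0)
  by_contra h
  have e0 : x 0 * (1 - x 0) = 0 := by
    rw [show 1 - x 0 = x 1 + x 2 by linarith]
    linarith
  have e1 : x 1 * (1 - x 1) = 0 := by
    rw [show 1 - x 1 = x 2 + x 0 by linarith]
    linarith
  have e2 : x 2 * (1 - x 2) = 0 := by
    rw [show 1 - x 2 = x 0 + x 1 by linarith]
    linarith
  have z : ∀ j, x j * (1 - x j) = 0 → x j = 0 := fun j hj =>
    (mul_eq_zero.1 hj).resolve_right (sub_ne_zero.2 (hx j).symm)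
  rw [z 0 e0, z 1 e1, z 2 e2] at h1
  norm_num at h1

theorem sideBump_of_eq_zero {x : stdSimplex ℝ (Fin 3)} (hx : ∀ j, x j ≠ 1) {k : Fin 3}
    (hk : x k = 0) (l : Fin 3) : sideBump l x = if l = k then 1 / 2 else 0 := by
  have h := sum_mul_pos hx
  unfold sideBump
  fin_cases k <;> fin_cases l <;> simp at hk ⊢ <;> simp [hk] at h ⊢ <;>
    rw [div_self h.ne'] <;> norm_num

theorem sideBump_toSide_zero (k l : Fin 3) : sideBump l (toSide k 0) = 0 := by
  simp [sideBump, toSide_apply]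
  norm_num

namespace DecoratedIdealTriangulation

variable {X : Type} [TopologicalSpace X] {P : Set X} {m : ℕ}
  (T : DecoratedIdealTriangulation X P m)

/-- The function equal to `sideBump` in the triangle of the side `s`, and to `0` in the other
triangles. -/
def bump {n : ℕ} (s : Side n) (x : TrianglePoint n) : ℝ :=
  (if x.1 = s.1 then 1 else 0) * sideBump s.2 x.2

theorem continuous_bump {n : ℕ} (s : Side n) :
    Continuous fun x : {x : TrianglePoint n // ¬ IsCorner x} => bump s x.1 := by
  have hc : ∀ j, Continuous fun x : {x : TrianglePoint n // ¬ IsCorner x} => x.1.2 j := fun j =>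
    (continuous_apply j).comp (continuous_subtype_val.comp
      (continuous_snd.comp continuous_subtype_val))
  have h1 : Continuous fun x : {x : TrianglePoint n // ¬ IsCorner x} =>
      if x.1.1 = s.1 then (1 : ℝ) else 0 :=
    (continuous_of_discreteTopology (f := fun μ : Fin n => if μ = s.1 then (1 : ℝ) else 0)).comp
      (continuous_fst.comp continuous_subtype_val)
  refine h1.mul (continuous_const.max (Continuous.sub (Continuous.div ?_ ?_ ?_) continuous_const))
  · exact (hc _).mul (hc _)
  · exact (((hc _).mul (hc _)).add ((hc _).mul (hc _))).add ((hc _).mul (hc _))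
  · intro x
    exact (sum_mul_pos fun j hj => x.2 ⟨j, hj⟩).ne'

theorem bump_of_eq_zero {n : ℕ} {x : TrianglePoint n} (hx : ¬ IsCorner x) {k : Fin 3}
    (hk : x.2 k = 0) (s : Side n) : bump s x = if s = (x.1, k) then 1 / 2 else 0 := by
  rw [bump, sideBump_of_eq_zero (fun j hj => hx ⟨j, hj⟩) hk]
  by_cases h1 : x.1 = s.1 <;> by_cases h2 : s.2 = k <;>
    simp [h1, h2, Prod.ext_iff, eq_comm (a := s.1)]

theorem bump_toSide_zero {n : ℕ} (s : Side n) (μ : Fin n) (k : Fin 3) :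
    bump s (μ, toSide k 0) = 0 := by
  simp [bump, sideBump_toSide_zero]

/-- The difference of the bumps at `s` and `t` is `1 / 2` on `s`, `-1 / 2` on `t` and `0` on all
other sides. The two nonzero values agree modulo `1`, so it descends to a circle-valued map on the
punctured surface. Along a half-edge the difference itself is a lift of that map, starting at `0` at
the barycenter. -/
theorem exists_winding {s t : Side (2 * m)} (hts : t ≠ s) (h : T.edge t = T.edge s) :
    ∃ A : C(unitInterval, (Pᶜ : Set X)) → ℝ, IsPathCocycle A ∧ ∀ r, A (T.halfEdge r) =
      (if s = r then 1 / 2 else 0) - (if t = r then 1 / 2 else 0) := by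
  let v : {x : TrianglePoint (2 * m) // ¬ IsCorner x} → ℝ := fun x => bump s x.1 - bump t x.1
  have hv : Continuous v := (continuous_bump s).sub (continuous_bump t)
  have hhalf : ((1 / 2 : ℝ) : AddCircle (1 : ℝ)) = ((-(1 / 2) : ℝ) : AddCircle (1 : ℝ)) := by
    rw [← sub_eq_zero, ← AddCircle.coe_sub, AddCircle.coe_eq_zero_iff]
    exact ⟨1, by norm_num⟩
  obtain ⟨q, hq⟩ := T.exists_descend (Y := AddCircle (1 : ℝ))
    (F := fun x => (v x : AddCircle (1 : ℝ))) ((AddCircle.continuous_mk' 1).comp hv) (by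
      rintro x y ⟨k, l, hne, he, hxk, hyl, -, -⟩
      simp only [v, bump_of_eq_zero x.2 hxk, bump_of_eq_zero y.2 hyl]
      by_cases h1 : s = (x.1.1, k)
      · have hy : t = (y.1.1, l) := T.opposite_unique hts (h1 ▸ hne.symm) h (by rw [h1, ← he])
        have h2 : s ≠ (y.1.1, l) := fun e => hts (hy.trans e.symm)
        have h3 : t ≠ (x.1.1, k) := fun e => hts (e.trans h1.symm)
        rw [if_pos h1, if_neg h2, if_neg h3, if_pos hy]
        simpa using hhalf
      · by_cases h2 : t = (x.1.1, k)
        · have hy : s = (y.1.1, l) :=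
            T.opposite_unique hts.symm (h2 ▸ hne.symm) h.symm (by rw [h2, ← he])
          have h3 : t ≠ (y.1.1, l) := fun e => hts (e.trans hy.symm)
          rw [if_neg h1, if_pos h2, if_pos hy, if_neg h3]
          simpa using hhalf.symm
        · have h3 : s ≠ (y.1.1, l) := by
            intro e
            exact h2 (T.opposite_unique hts (e ▸ hne) h (by rw [he, e]))
          have h4 : t ≠ (y.1.1, l) := by
            intro e
            exact h1 (T.opposite_unique hts.symm (e ▸ hne) h.symm (by rw [he, e]))
          rw [if_neg h1, if_neg h2, if_neg h3, if_neg h4])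
  refine ⟨winding q, isPathCocycle_winding q, fun r => ?_⟩
  have hp : Continuous fun t : unitInterval =>
      (⟨(r.1, toSide r.2 t), not_isCorner_toSide r t⟩ :
        {x : TrianglePoint (2 * m) // ¬ IsCorner x}) :=
    (continuous_const.prodMk (continuous_toSide r.2)).subtype_mk _
  have h1 : ((r.1, toSide r.2 1) : TrianglePoint (2 * m)).2 r.2 = 0 := by simp [toSide_apply]
  rw [winding_eq q (γ := T.halfEdge r) ⟨_, hv.comp hp⟩
    fun t => (hq ⟨_, not_isCorner_toSide r t⟩).symm]
  change v ⟨(r.1, toSide r.2 1), _⟩ - v ⟨(r.1, toSide r.2 0), _⟩ = _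
  simp only [v, bump_toSide_zero, bump_of_eq_zero (not_isCorner_toSide r 1) h1]
  simp

/-- The coefficient of a dual edge is determined by the homology class. The functional is built from
`s` alone, so it serves every orientation of the dual graph. -/
theorem exists_side_functional (s : Side (2 * m)) : ∃ W : H1 (Pᶜ : Set X) →ₗ[ℝ] ℝ,
    ∀ (ω : DualOrientation T.edge) (c : ω.cycles),
      (s = ω.start (T.edge s) → W (T.dualClass ω c) = -(c : Fin (3 * m) → ℝ) (T.edge s)) ∧
      (s = ω.finish (T.edge s) → W (T.dualClass ω c) = (c : Fin (3 * m) → ℝ) (T.edge s)) := by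
  obtain ⟨t, hts, h⟩ := T.exists_opposite s
  obtain ⟨A, hA, hhalf⟩ := T.exists_winding hts h
  -- The winding is `+1` along the dual edge leaving through `s`, whereas `f₃` puts `-c i` on the
  -- starting side.
  refine ⟨-hA.eval, fun ω c => ?_⟩
  have key : ∀ i, i ≠ T.edge s → A (T.dualEdge ω i) = 0 := by
    intro i hi
    have h1 : s ≠ ω.start i := fun e => hi (by rw [e, ω.edge_start])
    have h2 : s ≠ ω.finish i := fun e => hi (by rw [e, ω.edge_finish])
    have h3 : t ≠ ω.start i := fun e => hi (by rw [← h, e, ω.edge_start])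
    have h4 : t ≠ ω.finish i := fun e => hi (by rw [← h, e, ω.edge_finish])
    rw [T.apply_dualEdge hA, hhalf, hhalf, if_neg h1, if_neg h2, if_neg h3, if_neg h4]
    simp
  have hsum : hA.eval (T.dualClass ω c) =
      (c : Fin (3 * m) → ℝ) (T.edge s) * A (T.dualEdge ω (T.edge s)) := by
    rw [T.eval_dualClass hA]
    exact Finset.sum_eq_single _ (fun i _ hi => by rw [key i hi, mul_zero]) (by simp)
  rw [LinearMap.neg_apply, hsum, T.apply_dualEdge hA, hhalf, hhalf]
  have hne := ω.start_ne_finish (T.edge s)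
  constructor
  · intro e
    have h1 : t = ω.finish (T.edge s) :=
      T.opposite_unique hts (fun e' => hne (e.symm.trans e'.symm)) h (ω.edge_finish _)
    have h2 : s ≠ ω.finish (T.edge s) := fun e' => hne (e.symm.trans e')
    have h3 : t ≠ ω.start (T.edge s) := fun e' => hne (e'.symm.trans h1)
    rw [if_pos e, if_neg h2, if_neg h3, if_pos h1]
    norm_num
  · intro e
    have h1 : t = ω.start (T.edge s) :=
      T.opposite_unique hts (fun e' => hne (e'.trans e)) h (ω.edge_start _)
    have h2 : s ≠ ω.start (T.edge s) := fun e' => hne (e'.symm.trans e)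
    have h3 : t ≠ ω.finish (T.edge s) := fun e' => hne (h1.symm.trans e')
    rw [if_pos e, if_neg h2, if_neg h3, if_pos h1]
    norm_num

end DecoratedIdealTriangulation

/-! ### Local primitives of path cocycles -/

namespace IsPathCocycle

variable {S : Type*} [TopologicalSpace S] {A : C(unitInterval, S) → ℝ}

/-- A path cocycle with local primitives all given by the same function is the coboundary of
this function. -/
theorem eq_sub_of_locally (hA : IsPathCocycle A) (f : S → ℝ)
    (hf : ∀ x, ∃ V ∈ nhds x, ∀ γ : C(unitInterval, S), (∀ t, γ t ∈ V) → A γ = f (γ 1) - f (γ 0))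
    (γ : C(unitInterval, S)) : A γ = f (γ 1) - f (γ 0) := by
  have hC : Convex ℝ (Set.Icc (0 : ℝ) 1) := convex_Icc 0 1
  have hs0 : ∀ a b : unitInterval, segmentMap hC a b (0 : unitInterval) = a := fun a b =>
    Subtype.ext (by simp [segmentMap])
  have hs1 : ∀ a b : unitInterval, segmentMap hC a b (1 : unitInterval) = b := fun a b =>
    Subtype.ext (by simp [segmentMap])
  -- The defect of the formula on the initial part of `γ` up to time `t`. Near `t₀` it changes by
  -- the defect on a short subpath lying in `V`, which is zero.
  let φ : unitInterval → ℝ := fun t => A (γ.comp (segmentMap hC 0 t)) - f (γ t)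
  have hφ : IsLocallyConstant φ := by
    rw [IsLocallyConstant.iff_eventually_eq]
    intro t₀
    obtain ⟨V, hV, hVf⟩ := hf (γ t₀)
    obtain ⟨ε, hε, hball⟩ := Metric.mem_nhds_iff.1 (γ.continuous.continuousAt.preimage_mem_nhds hV)
    filter_upwards [Metric.ball_mem_nhds t₀ hε] with t ht
    have h1 := hVf (γ.comp (segmentMap hC t₀ t)) fun u => hball (by
      have hsub : (segmentMap hC t₀ t u : ℝ) - t₀ = u * (t - t₀) := by
        simp [segmentMap]
        ring
      have hd : |(t : ℝ) - t₀| < ε := ht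
      change |(segmentMap hC t₀ t u : ℝ) - t₀| < ε
      rw [hsub, abs_mul, abs_of_nonneg u.2.1]
      exact lt_of_le_of_lt (mul_le_of_le_one_left (abs_nonneg _) u.2.2) hd)
    have h2 := hA.subsegment_add γ 0 t₀ t
    have h3 : γ.comp (segmentMap hC t₀ t) 1 = γ t := congrArg γ (hs1 t₀ t)
    have h4 : γ.comp (segmentMap hC t₀ t) 0 = γ t₀ := congrArg γ (hs0 t₀ t)
    rw [h3, h4] at h1
    simp only [φ]
    linarith
  have h := hφ.apply_eq_of_preconnectedSpace 1 0
  have h0 : γ.comp (segmentMap hC (0 : unitInterval) (0 : unitInterval)) =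
      ContinuousMap.const _ (γ 0) := by
    ext t
    exact congrArg γ (Subtype.ext (by simp [segmentMap]))
  have h1 : γ.comp (segmentMap hC (0 : unitInterval) (1 : unitInterval)) = γ := by
    ext t
    exact congrArg γ (Subtype.ext (by simp [segmentMap]))
  simp only [φ, h0, h1, hA.const] at h
  linarith

/-- The value of a path cocycle on a path in a set which can be contracted to a point. -/
theorem eq_sub_of_contraction (hA : IsPathCocycle A) {V : Set S} {K : S → C(unitInterval, S)}
    (hK : ContinuousOn K V) {p : S} (h0 : ∀ x ∈ V, K x 0 = x) (h1 : ∀ x ∈ V, K x 1 = p)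
    (γ : C(unitInterval, S)) (hγ : ∀ t, γ t ∈ V) : A γ = A (K (γ 0)) - A (K (γ 1)) := by
  let κ : C(unitInterval, C(unitInterval, S)) :=
    ⟨fun t => K (γ t), hK.comp_continuous γ.continuous hγ⟩
  -- The contraction sweeps out a square with `γ` on one side, the constant path at `p` on the
  -- opposite side, and the tracks of the endpoints of `γ` on the other two.
  have h := hA.square κ.uncurry
  have e1 : κ.uncurry.comp (.prodMk (.id _) (.const _ 0)) = γ := by
    ext t
    exact h0 _ (hγ t)
  have e2 : κ.uncurry.comp (.prodMk (.const _ 1) (.id _)) = K (γ 1) := rfl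
  have e3 : κ.uncurry.comp (.prodMk (.const _ 0) (.id _)) = K (γ 0) := rfl
  have e4 : κ.uncurry.comp (.prodMk (.id _) (.const _ 1)) = ContinuousMap.const _ p := by
    ext t
    exact h1 _ (hγ t)
  rw [e1, e2, e3, e4, hA.const] at h
  linarith

end IsPathCocycle

/-! ### The triangle without its corners -/

/-- The standard triangle without its corners. -/
def puncturedTriangle : Set (Fin 3 → ℝ) := {p | p ∈ stdSimplex ℝ (Fin 3) ∧ ∀ j, p j ≠ 1}

theorem convex_puncturedTriangle : Convex ℝ puncturedTriangle := by
  have h : puncturedTriangle = stdSimplex ℝ (Fin 3) ∩ ⋂ j, {p | p j < 1} := by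
    ext p
    simp only [puncturedTriangle, Set.mem_ofPred_eq, Set.mem_inter_iff, Set.mem_iInter]
    refine and_congr_right fun hp => forall_congr' fun j => ?_
    exact ⟨fun h => lt_of_le_of_ne (mem_Icc_of_mem_stdSimplex hp j).2 h, fun h => h.ne⟩
  rw [h]
  exact (convex_stdSimplex ℝ (Fin 3)).inter (convex_iInter fun j =>
    convex_halfSpace_lt (LinearMap.proj (R := ℝ) j).isLinear 1)

theorem Glue.symm {n e : ℕ} {edge : Side n → Fin e} {x y : TrianglePoint n}
    (h : Glue edge x y) : Glue edge y x := by
  obtain ⟨k, l, hne, he, hx, hy, h1, h2⟩ := h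
  exact ⟨l, k, hne.symm, he.symm, hy, hx, h2.symm, h1.symm⟩

/-- A point of the triangle without its corners on the segment from the barycenter to the
midpoint of a side. -/
def spoke (k : Fin 3) (t : unitInterval) : puncturedTriangle :=
  ⟨toSide k t, (toSide k t).2, fun j hj => not_isCorner_toSide ((0, k) : Side 1) t ⟨j, hj⟩⟩

/-- Here `spoke 0 0` is the barycenter, the index being irrelevant at time `0`, and `spoke k 1` is
the midpoint of side `k`. -/
theorem segmentMap_spoke (k : Fin 3) :
    ⇑(segmentMap convex_puncturedTriangle (spoke 0 0) (spoke k 1)) = spoke k := by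
  ext t j
  change (1 - (t : ℝ)) * toSide 0 0 j + t * toSide k 1 j = toSide k t j
  simp only [toSide_apply]
  split_ifs <;> simp <;> ring

namespace DecoratedIdealTriangulation

variable {X : Type} [TopologicalSpace X] {P : Set X} {m : ℕ}
  (T : DecoratedIdealTriangulation X P m)

/-- The inclusion of the triangles without their corners in the disjoint union of the
triangles. -/
def toPoint {n : ℕ} (x : Fin n × puncturedTriangle) : TrianglePoint n := (x.1, ⟨x.2.1, x.2.2.1⟩)

theorem not_isCorner_toPoint {n : ℕ} (x : Fin n × puncturedTriangle) : ¬ IsCorner (toPoint x) :=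
  fun ⟨j, hj⟩ => x.2.2.2 j hj

/-- The triangles without their corners, in the punctured surface. -/
def cell (x : Fin (2 * m) × puncturedTriangle) : (Pᶜ : Set X) :=
  T.proj ⟨toPoint x, not_isCorner_toPoint x⟩

theorem isQuotientMap_cell : Topology.IsQuotientMap T.cell := by
  let e : (Fin (2 * m) × puncturedTriangle) ≃ₜ {x : TrianglePoint (2 * m) // ¬ IsCorner x} :=
    { toFun := fun x => ⟨toPoint x, not_isCorner_toPoint x⟩
      invFun := fun x => (x.1.1, ⟨x.1.2.1, x.1.2.2, fun j hj => x.2 ⟨j, hj⟩⟩)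
      left_inv := fun x => rfl
      right_inv := fun x => rfl
      continuous_toFun := by
        refine Continuous.subtype_mk (continuous_fst.prodMk (Continuous.subtype_mk ?_ _)) _
        exact continuous_subtype_val.comp continuous_snd
      continuous_invFun := by
        refine (continuous_fst.comp continuous_subtype_val).prodMk (Continuous.subtype_mk ?_ _)
        exact continuous_subtype_val.comp (continuous_snd.comp continuous_subtype_val) }
  exact T.isQuotientMap_proj.comp e.isQuotientMap

theorem eq_of_cell_eq {Y : Type*} {F : Fin (2 * m) × puncturedTriangle → Y}
    (hF : ∀ x y, Glue T.edge (toPoint x) (toPoint y) → F x = F y)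
    {x y : Fin (2 * m) × puncturedTriangle} (h : T.cell x = T.cell y) : F x = F y :=
  T.eq_of_proj_eq (F := fun z => F (z.1.1, ⟨z.1.2.1, z.1.2.2, fun j hj => z.2 ⟨j, hj⟩⟩))
    (fun _ _ h => hF _ _ h) h

theorem cell_eq_of_glue {x y : Fin (2 * m) × puncturedTriangle}
    (h : Glue T.edge (toPoint x) (toPoint y)) : T.cell x = T.cell y :=
  T.proj_eq_of_glue (x := ⟨_, not_isCorner_toPoint x⟩) (y := ⟨_, not_isCorner_toPoint y⟩) h

/-- The segment from a point of a triangle to another point of the same triangle, in the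
punctured surface. -/
def segment : C((Fin (2 * m) × puncturedTriangle) × puncturedTriangle,
    C(unitInterval, (Pᶜ : Set X))) :=
  ContinuousMap.curry ⟨fun z => T.cell
    (z.1.1.1, segmentMap convex_puncturedTriangle z.1.1.2 z.1.2 z.2), by
      refine T.isQuotientMap_cell.continuous.comp (Continuous.prodMk (by fun_prop) ?_)
      refine Continuous.subtype_mk ?_ _
      fun_prop⟩

theorem segment_apply (x : Fin (2 * m) × puncturedTriangle) (a : puncturedTriangle)
    (t : unitInterval) : T.segment (x, a) t =
      T.cell (x.1, segmentMap convex_puncturedTriangle x.2 a t) := rfl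

theorem segment_zero (x : Fin (2 * m) × puncturedTriangle) (a : puncturedTriangle) :
    T.segment (x, a) 0 = T.cell x := by
  rw [segment_apply]
  congr 2
  exact Subtype.ext (by simp [segmentMap])

theorem segment_one (x : Fin (2 * m) × puncturedTriangle) (a : puncturedTriangle) :
    T.segment (x, a) 1 = T.cell (x.1, a) := by
  rw [segment_apply]
  congr 2
  exact Subtype.ext (by simp [segmentMap])

theorem halfEdge_eq_segment (s : Side (2 * m)) :
    (T.halfEdge s : C(unitInterval, (Pᶜ : Set X))) = T.segment ((s.1, spoke 0 0), spoke s.2 1) := by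
  ext t
  rw [segment_apply, segmentMap_spoke]
  rfl

theorem segment_add {A : C(unitInterval, (Pᶜ : Set X)) → ℝ} (hA : IsPathCocycle A)
    (μ : Fin (2 * m)) (a b c : puncturedTriangle) :
    A (T.segment ((μ, a), b)) + A (T.segment ((μ, b), c)) = A (T.segment ((μ, a), c)) :=
  hA.segment_add convex_puncturedTriangle
    ⟨fun p => T.cell (μ, p), T.isQuotientMap_cell.continuous.comp (by fun_prop)⟩ a b c

/-- The segments to the midpoints of two glued sides from two points glued along these sides
coincide. -/
theorem segment_eq_of_glue {s t : Side (2 * m)} (hst : s ≠ t) (he : T.edge s = T.edge t)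
    {p q : puncturedTriangle} (hp : p.1 s.2 = 0) (hq : q.1 t.2 = 0)
    (h1 : p.1 (s.2 + 1) = q.1 (t.2 + 2)) (h2 : p.1 (s.2 + 2) = q.1 (t.2 + 1)) :
    T.segment ((s.1, p), spoke s.2 1) = T.segment ((t.1, q), spoke t.2 1) := by
  have key : ∀ k : Fin 3, k + 1 ≠ k ∧ k + 2 ≠ k := by decide
  have hv : ∀ (k : Fin 3) (p : puncturedTriangle) (u : unitInterval) (j : Fin 3),
      (segmentMap convex_puncturedTriangle p (spoke k 1) u).1 j =
        (1 - (u : ℝ)) * p.1 j + u * toSide k 1 j := fun _ _ _ _ => rfl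
  ext1 u
  rw [segment_apply, segment_apply]
  refine T.cell_eq_of_glue ⟨s.2, t.2, hst, he, ?_, ?_, ?_, ?_⟩
  · refine (hv _ _ _ _).trans ?_
    simp [hp, toSide_apply]
  · refine (hv _ _ _ _).trans ?_
    simp [hq, toSide_apply]
  · refine (hv _ _ _ _).trans (Eq.trans ?_ (hv _ _ _ _).symm)
    simp [h1, toSide_apply, key]
  · refine (hv _ _ _ _).trans (Eq.trans ?_ (hv _ _ _ _).symm)
    simp [h2, toSide_apply, key]

/-! ### Primitives of path cocycles on the punctured surface -/

/-- The part of a triangle close to the side `s`, bounded by `s` and the segments from the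
barycenter to the ends of `s`. -/
def sector {n : ℕ} (s : Side n) : Set (Fin n × puncturedTriangle) :=
  {x | x.1 = s.1 ∧ x.2.1 s.2 < x.2.1 (s.2 + 1) ∧ x.2.1 s.2 < x.2.1 (s.2 + 2)}

theorem isOpen_fst_eq {n : ℕ} (μ : Fin n) :
    IsOpen {x : Fin n × puncturedTriangle | x.1 = μ} :=
  (isOpen_discrete {μ}).preimage continuous_fst

theorem continuous_coord {n : ℕ} (j : Fin 3) :
    Continuous fun x : Fin n × puncturedTriangle => x.2.1 j :=
  (continuous_apply j).comp (continuous_subtype_val.comp continuous_snd)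

theorem isOpen_sector {n : ℕ} (s : Side n) : IsOpen (sector s) :=
  (isOpen_fst_eq s.1).inter ((isOpen_lt (continuous_coord _) (continuous_coord _)).inter
    (isOpen_lt (continuous_coord _) (continuous_coord _)))

/-- In the sector of a side, its coordinate is the strict minimum of the three. -/
theorem disjoint_sector {n : ℕ} {s t : Side n} (hst : s ≠ t) : Disjoint (sector s) (sector t) := by
  rw [Set.disjoint_left]
  rintro x ⟨hs, hs1, hs2⟩ ⟨ht, ht1, ht2⟩
  have key : ∀ k l : Fin 3, k ≠ l → (l = k + 1 ∨ l = k + 2) ∧ (k = l + 1 ∨ k = l + 2) := by decide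
  have hne : s.2 ≠ t.2 := fun h => hst (Prod.ext (hs.symm.trans ht) h)
  obtain ⟨h1, h2⟩ := key _ _ hne
  have h3 : x.2.1 s.2 < x.2.1 t.2 := by
    rcases h1 with h | h <;> rw [h] <;> assumption
  have h4 : x.2.1 t.2 < x.2.1 s.2 := by
    rcases h2 with h | h <;> rw [h] <;> assumption
  exact lt_asymm h3 h4

theorem mem_sector_of_eq_zero {n : ℕ} {x : Fin n × puncturedTriangle} {k : Fin 3}
    (hk : x.2.1 k = 0) : x ∈ sector (x.1, k) := by
  have h0 : ∀ j, 0 ≤ x.2.1 j := x.2.2.1.1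
  have h1 := x.2.2.1.2
  have h2 := x.2.2.2
  rw [Fin.sum_univ_three] at h1
  have hpos : ∀ j, j ≠ k → 0 < x.2.1 j := by
    intro j hj
    refine lt_of_le_of_ne (h0 j) fun hj0 => ?_
    obtain ⟨i, hi⟩ : ∃ i : Fin 3, x.2.1 i = 1 := by
      rw [eq_comm] at hj0
      fin_cases k <;> fin_cases j <;> simp at hj hk hj0 <;> simp [hk, hj0] at h1 <;> exact ⟨_, h1⟩
    exact h2 i hi
  have key : ∀ k : Fin 3, k + 1 ≠ k ∧ k + 2 ≠ k := by decide
  exact ⟨rfl, hk.trans_lt (hpos _ (key k).1), hk.trans_lt (hpos _ (key k).2)⟩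

/-- A point glued to a point of the sector of the side `s` is in the sector of the opposite
side. -/
theorem mem_sector_of_glue {s t : Side (2 * m)} (hts : t ≠ s) (he : T.edge t = T.edge s)
    {x y : Fin (2 * m) × puncturedTriangle} (h : Glue T.edge (toPoint x) (toPoint y))
    (hx : x ∈ sector s) : y ∈ sector t ∧ x.2.1 s.2 = 0 ∧ y.2.1 t.2 = 0 ∧
      x.2.1 (s.2 + 1) = y.2.1 (t.2 + 2) ∧ x.2.1 (s.2 + 2) = y.2.1 (t.2 + 1) := by
  obtain ⟨k, l, hne, hedge, hxk, hyl, h1, h2⟩ := h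
  change x.2.1 k = 0 at hxk
  change y.2.1 l = 0 at hyl
  have hs : s = (x.1, k) := by
    by_contra hs
    exact Set.disjoint_left.1 (disjoint_sector hs) hx (mem_sector_of_eq_zero hxk)
  have ht : t = (y.1, l) :=
    T.opposite_unique hts (hs ▸ hne.symm) he (hedge.symm.trans (congrArg T.edge hs.symm))
  subst hs ht
  exact ⟨mem_sector_of_eq_zero hyl, hxk, hyl, h1, h2⟩

section Primitive

variable {A : C(unitInterval, (Pᶜ : Set X)) → ℝ} (g : Fin (2 * m) → ℝ)

/-- The integral of a path cocycle from the barycenter of a triangle, up to a constant for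
each triangle. -/
def cellPrimitive (A : C(unitInterval, (Pᶜ : Set X)) → ℝ) (x : Fin (2 * m) × puncturedTriangle) :
    ℝ := g x.1 + A (T.segment ((x.1, spoke 0 0), x.2))

theorem cellPrimitive_sub (hA : IsPathCocycle A) (x : Fin (2 * m) × puncturedTriangle)
    (a : puncturedTriangle) :
    T.cellPrimitive g A x = T.cellPrimitive g A (x.1, a) - A (T.segment (x, a)) := by
  have h := T.segment_add hA x.1 (spoke 0 0) x.2 a
  simp only [cellPrimitive]
  change _ = _ - A (T.segment ((x.1, x.2), a))
  linarith

/-- Both values can be computed by passing through the midpoint of the common edge. There they agree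
by `hg`, and the segments from the two glued points to the midpoint are the same path in the
surface. -/
theorem cellPrimitive_eq_of_glue (hA : IsPathCocycle A)
    (hg : ∀ s t, s ≠ t → T.edge s = T.edge t →
      g s.1 + A (T.halfEdge s) = g t.1 + A (T.halfEdge t))
    {x y : Fin (2 * m) × puncturedTriangle} (h : Glue T.edge (toPoint x) (toPoint y)) :
    T.cellPrimitive g A x = T.cellPrimitive g A y := by
  obtain ⟨k, l, hne, he, hx, hy, h1, h2⟩ := h
  rw [T.cellPrimitive_sub g hA x (spoke k 1), T.cellPrimitive_sub g hA y (spoke l 1)]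
  have h3 := hg _ _ hne he
  rw [T.halfEdge_eq_segment, T.halfEdge_eq_segment] at h3
  have h4 := T.segment_eq_of_glue hne he (p := x.2) (q := y.2) hx hy h1 h2
  exact congrArg₂ (· - ·) h3 (congrArg A h4)

/-- The function `f` is a primitive of the cocycle `A` on the image of a saturated open set which
can be contracted to a point along segments in the triangles. -/
theorem eq_sub_of_star (hA : IsPathCocycle A) {f : (Pᶜ : Set X) → ℝ}
    (hf : ∀ x, f (T.cell x) = T.cellPrimitive g A x) {U : Set (Fin (2 * m) × puncturedTriangle)}
    (hU : IsOpen U) (hsat : ∀ x y, Glue T.edge (toPoint x) (toPoint y) → x ∈ U → y ∈ U)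
    {a : Fin (2 * m) × puncturedTriangle → puncturedTriangle} (ha : ContinuousOn a U)
    (hseg : ∀ x y, Glue T.edge (toPoint x) (toPoint y) → x ∈ U →
      T.segment (x, a x) = T.segment (y, a y)) {p : (Pᶜ : Set X)}
    (hp : ∀ x ∈ U, T.cell (x.1, a x) = p) {x₀ : Fin (2 * m) × puncturedTriangle} (hx₀ : x₀ ∈ U) :
    ∃ V ∈ nhds (T.cell x₀), ∀ γ : C(unitInterval, (Pᶜ : Set X)), (∀ t, γ t ∈ V) →
      A γ = f (γ 1) - f (γ 0) := by
  classical
  have hmem : ∀ x y, T.cell x = T.cell y → (x ∈ U ↔ y ∈ U) := fun x y h =>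
    iff_of_eq (T.eq_of_cell_eq (F := fun x => x ∈ U)
      (fun x y h => propext ⟨hsat x y h, hsat y x h.symm⟩) h)
  have hpre : T.cell ⁻¹' (T.cell '' U) = U := by
    ext x
    refine ⟨?_, fun hx => ⟨x, hx, rfl⟩⟩
    rintro ⟨y, hy, hyx⟩
    exact (hmem _ _ hyx).1 hy
  have hopen : IsOpen (T.cell '' U) := by
    rw [← T.isQuotientMap_cell.isOpen_preimage, hpre]
    exact hU
  -- The value outside `U` is a filler, chosen to depend only on `T.cell x` so that `F` is constant
  -- on the fibers of `T.cell`.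
  let F : Fin (2 * m) × puncturedTriangle → C(unitInterval, (Pᶜ : Set X)) := fun x =>
    if x ∈ U then T.segment (x, a x) else ContinuousMap.const _ (T.cell x)
  have hF : ∀ x y, T.cell x = T.cell y → F x = F y := fun x y h => T.eq_of_cell_eq (F := F) (by
    intro x y hxy
    by_cases hx : x ∈ U
    · simp only [F, if_pos hx, if_pos (hsat x y hxy hx), hseg x y hxy hx]
    · have hy : y ∉ U := fun hy => hx (hsat y x hxy.symm hy)
      simp only [F, if_neg hx, if_neg hy, T.cell_eq_of_glue hxy]) h
  let r := Function.surjInv T.isQuotientMap_cell.surjective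
  have hr : ∀ v, T.cell (r v) = v := Function.surjInv_eq T.isQuotientMap_cell.surjective
  let K : (Pᶜ : Set X) → C(unitInterval, (Pᶜ : Set X)) := fun v => F (r v)
  have hK : ∀ x, K (T.cell x) = F x := fun x => hF _ _ (hr _)
  have hKU : ∀ x ∈ U, K (T.cell x) = T.segment (x, a x) := fun x hx => (hK x).trans (if_pos hx)
  have hKc : ContinuousOn K (T.cell '' U) := by
    -- The section `r` need not be continuous. Continuity of `K` is checked upstairs, where it is
    -- the continuous family of segments.
    rw [T.isQuotientMap_cell.continuousOn_isOpen_iff hopen, hpre]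
    refine ContinuousOn.congr (f := fun x => T.segment (x, a x)) ?_ fun x hx => hKU x hx
    exact T.segment.continuous.comp_continuousOn (continuousOn_id.prodMk ha)
  refine ⟨T.cell '' U, hopen.mem_nhds ⟨x₀, hx₀, rfl⟩, fun γ hγ => ?_⟩
  have hfK : ∀ v ∈ T.cell '' U, f v = f p - A (K v) := by
    rintro _ ⟨x, hx, rfl⟩
    rw [hKU x hx, ← hp x hx, hf, hf]
    exact T.cellPrimitive_sub g hA x (a x)
  rw [hA.eq_sub_of_contraction hKc (p := p) ?_ ?_ γ hγ, hfK _ (hγ 0), hfK _ (hγ 1)]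
  · ring
  · rintro _ ⟨x, hx, rfl⟩
    rw [hKU x hx, T.segment_zero]
  · rintro _ ⟨x, hx, rfl⟩
    rw [hKU x hx, T.segment_one, hp x hx]

/-- The hypothesis `hg` makes `g` a potential on the dual graph, so `cellPrimitive` descends to the
surface. Locally there are two cases: a point on an edge has the two adjacent sectors as a star
around the midpoint, and any other point has its open triangle as a star around the barycenter. -/
theorem exists_primitive (hA : IsPathCocycle A)
    (hg : ∀ s t, s ≠ t → T.edge s = T.edge t →
      g s.1 + A (T.halfEdge s) = g t.1 + A (T.halfEdge t)) :
    ∃ f : (Pᶜ : Set X) → ℝ, ∀ γ, A γ = f (γ 1) - f (γ 0) := by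
  classical
  let r := Function.surjInv T.isQuotientMap_cell.surjective
  have hr : ∀ v, T.cell (r v) = v := Function.surjInv_eq T.isQuotientMap_cell.surjective
  let f : (Pᶜ : Set X) → ℝ := fun v => T.cellPrimitive g A (r v)
  have hf : ∀ x, f (T.cell x) = T.cellPrimitive g A x := fun x =>
    T.eq_of_cell_eq (fun _ _ h => T.cellPrimitive_eq_of_glue g hA hg h) (hr _)
  refine ⟨f, hA.eq_sub_of_locally f fun v => ?_⟩
  obtain ⟨x₀, rfl⟩ := T.isQuotientMap_cell.surjective v
  by_cases hx₀ : ∃ k, x₀.2.1 k = 0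
  · obtain ⟨k, hk⟩ := hx₀
    obtain ⟨t, hts, he⟩ := T.exists_opposite (x₀.1, k)
    have hxs := mem_sector_of_eq_zero hk
    generalize (x₀.1, k) = s at hts he hxs
    have hdisj := disjoint_sector hts
    let a : Fin (2 * m) × puncturedTriangle → puncturedTriangle := fun x =>
      if x ∈ sector s then spoke s.2 1 else spoke t.2 1
    have has : ∀ x ∈ sector s, a x = spoke s.2 1 := fun x hx => if_pos hx
    have hat : ∀ x ∈ sector t, a x = spoke t.2 1 := fun x hx =>
      if_neg (Set.disjoint_left.1 hdisj hx)
    have hseg₁ : ∀ (s t : Side (2 * m)), t ≠ s → T.edge t = T.edge s →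
        ∀ x y, Glue T.edge (toPoint x) (toPoint y) → x ∈ sector s →
          T.segment (x, spoke s.2 1) = T.segment (y, spoke t.2 1) := by
      rintro s t hts he ⟨_, p⟩ ⟨_, q⟩ hxy hx
      obtain ⟨hy, h1, h2, h3, h4⟩ := T.mem_sector_of_glue hts he hxy hx
      obtain ⟨rfl, -⟩ := hx
      obtain ⟨rfl, -⟩ := hy
      exact T.segment_eq_of_glue hts.symm he.symm h1 h2 h3 h4
    refine T.eq_sub_of_star g hA hf (U := sector s ∪ sector t) (a := a)
      ((isOpen_sector s).union (isOpen_sector t)) ?_ ?_ ?_ (p := T.midpoint s) ?_ (Or.inl hxs)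
    · rintro x y hxy (hx | hx)
      · exact Or.inr (T.mem_sector_of_glue hts he hxy hx).1
      · exact Or.inl (T.mem_sector_of_glue hts.symm he.symm hxy hx).1
    · refine ContinuousOn.union_of_isOpen ?_ ?_ (isOpen_sector s) (isOpen_sector t)
      · exact continuousOn_const.congr has
      · exact continuousOn_const.congr hat
    · rintro x y hxy (hx | hx)
      · rw [has x hx, hat y (T.mem_sector_of_glue hts he hxy hx).1]
        exact hseg₁ s t hts he x y hxy hx
      · rw [hat x hx, has y (T.mem_sector_of_glue hts.symm he.symm hxy hx).1]
        exact hseg₁ t s hts.symm he.symm x y hxy hx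
    · rintro x (hx | hx)
      · rw [has x hx, hx.1]
        rfl
      · rw [hat x hx, hx.1, T.midpoint_eq hts.symm he.symm]
        rfl
  · have hpos : ∀ j, 0 < x₀.2.1 j := fun j =>
      lt_of_le_of_ne (x₀.2.2.1.1 j) fun h => hx₀ ⟨j, h.symm⟩
    -- Interior points are glued to nothing, so the compatibility conditions are vacuous on an open
    -- triangle.
    have hno : ∀ x y : Fin (2 * m) × puncturedTriangle, Glue T.edge (toPoint x) (toPoint y) →
        (∀ j, 0 < x.2.1 j) → False := by
      rintro x y ⟨k, -, -, -, hxk, -⟩ hx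
      exact (hx k).ne' hxk
    refine T.eq_sub_of_star g hA hf (U := {x | x.1 = x₀.1} ∩ ⋂ j, {x | 0 < x.2.1 j})
      (a := fun _ => spoke 0 0) ?_ ?_ continuousOn_const ?_ (p := T.center x₀.1) ?_
      ⟨rfl, Set.mem_iInter.2 hpos⟩
    · exact (isOpen_fst_eq _).inter (isOpen_iInter_of_finite fun j =>
        isOpen_lt continuous_const (continuous_coord j))
    · exact fun x y hxy hx => (hno x y hxy (Set.mem_iInter.1 hx.2)).elim
    · exact fun x y hxy hx => (hno x y hxy (Set.mem_iInter.1 hx.2)).elim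
    · rintro x ⟨hx, -⟩
      rw [show x.1 = x₀.1 from hx]
      rfl

end Primitive

/-- The dual graph generates the first homology group of the punctured surface. -/
theorem surjective_dualClass (ω : DualOrientation T.edge) :
    Function.Surjective (T.dualClass ω) := by
  rw [← LinearMap.range_eq_top]
  by_contra hne
  obtain ⟨l, hl, hrange⟩ := Submodule.exists_le_ker_of_lt_top _ (lt_top_iff_ne_top.2 hne)
  obtain ⟨A, hA, rfl⟩ := exists_eval_eq l
  let φ : Module.Dual ℝ (Fin (3 * m) → ℝ) :=
    Fintype.linearCombination ℝ fun i => A (T.dualEdge ω i)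
  -- The values of `A` on the dual edges vanish on all cycles of the graph, so they factor through
  -- the boundary map as some `ψ`. The values of `ψ` on the basis vectors are the potential on the
  -- triangles.
  have hφ : φ ∈ ω.boundary.ker.dualAnnihilator := by
    rw [Submodule.mem_dualAnnihilator]
    intro c hc
    have h : hA.eval (T.dualClass ω ⟨c, hc⟩) = 0 := hrange ⟨_, rfl⟩
    rw [T.eval_dualClass hA] at h
    simpa [φ, Fintype.linearCombination_apply] using h
  rw [← LinearMap.range_dualMap_eq_dualAnnihilator_ker] at hφ
  obtain ⟨ψ, hψ⟩ := hφ
  have hd : ∀ i, A (T.dualEdge ω i) =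
      ψ (Pi.single (ω.finish i).1 1) - ψ (Pi.single (ω.start i).1 1) := by
    intro i
    have h := LinearMap.congr_fun hψ (Pi.single i 1)
    simp only [φ, LinearMap.dualMap_apply, DualOrientation.boundary,
      Fintype.linearCombination_apply_single, one_smul, map_sub] at h
    exact h.symm
  obtain ⟨f, hf⟩ := T.exists_primitive (fun μ => ψ (Pi.single μ 1)) hA (by
    have key : ∀ i, ψ (Pi.single (ω.start i).1 1) + A (T.halfEdge (ω.start i)) =
        ψ (Pi.single (ω.finish i).1 1) + A (T.halfEdge (ω.finish i)) := by
      intro i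
      have h := hd i
      rw [T.apply_dualEdge hA] at h
      linarith
    intro s t hst he
    have hs := T.eq_start_or_finish ω s
    have ht := T.eq_start_or_finish ω t
    rw [← he] at ht
    rcases hs with hs | hs <;> rcases ht with ht | ht
    · exact (hst (hs.trans ht.symm)).elim
    · rw [hs, ht]
      exact key _
    · rw [hs, ht]
      exact (key _).symm
    · exact (hst (hs.trans ht.symm)).elim)
  exact hl (hA.eval_eq_zero f hf)

end DecoratedIdealTriangulation

/-! ### Exactness of the sequence -/

theorem lnH_ext {m : ℕ} {v w : KashaevSpace m} (h : ∀ s, lnH s v = lnH s w) : v = w := by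
  funext μ
  have h1 := h (μ, 1)
  have h2 := h (μ, 2)
  simp only [lnH, LinearMap.comp_apply, LinearMap.proj_apply, LinearMap.neg_apply,
    LinearMap.fst_apply, LinearMap.snd_apply, neg_inj] at h1 h2
  exact Prod.ext h2 h1

theorem sum_lnH {m : ℕ} (μ : Fin (2 * m)) (v : KashaevSpace m) : ∑ k, lnH (μ, k) v = 0 := by
  rw [Fin.sum_univ_three]
  simp [lnH]

namespace DecoratedIdealTriangulation

variable {X : Type} [TopologicalSpace X] {P : Set X} {m : ℕ}
  (T : DecoratedIdealTriangulation X P m)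

/-- The boundary of a chain of the dual graph at a triangle is the sum of the numbers it defines
on the sides of this triangle. -/
theorem boundary_apply (ω : DualOrientation T.edge) (c : Fin (3 * m) → ℝ) (b : Side (2 * m) → ℝ)
    (hs : ∀ i, b (ω.start i) = -c i) (hf : ∀ i, b (ω.finish i) = c i) (μ : Fin (2 * m)) :
    ω.boundary c μ = ∑ k, b (μ, k) := by
  have h1 : ∑ k, b (μ, k) = ∑ s : Side (2 * m), if s.1 = μ then b s else 0 := by
    rw [Fintype.sum_prod_type, Finset.sum_eq_single μ]
    · simp
    · intro ν _ hν
      simp [hν]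
    · simp
  rw [h1, T.sum_sides ω, DualOrientation.boundary, Fintype.linearCombination_apply,
    Finset.sum_apply]
  refine Finset.sum_congr rfl fun i _ => ?_
  rw [hs, hf, Pi.smul_apply, Pi.sub_apply, Pi.single_apply, Pi.single_apply]
  simp only [eq_comm (a := μ)]
  split_ifs <;> simp

theorem f₂_apply (ω : DualOrientation T.edge) (v : KashaevSpace m) (i : Fin (3 * m)) :
    f₂ T v i = lnH (ω.start i) v + lnH (ω.finish i) v := by
  rw [f₂, LinearMap.pi_apply, T.filter_edge_eq ω, Finset.sum_pair (ω.start_ne_finish i),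
    LinearMap.add_apply]

/-- The sum over the edges is a sum over all sides, and the three sides of each triangle contribute
zero. -/
theorem f₁_f₂ (v : KashaevSpace m) : f₁ m (f₂ T v) = 0 := by
  obtain ⟨ω⟩ := T.nonempty_dualOrientation
  simp only [f₁, LinearMap.sum_apply, LinearMap.proj_apply, T.f₂_apply ω]
  rw [← T.sum_sides ω fun s => lnH s v, Fintype.sum_prod_type]
  exact Finset.sum_eq_zero fun μ _ => sum_lnH μ v

/-- There is a linear map with the defining property of `f₃`. -/
theorem exists_f₃ : ∃ f₃ : H1 (Pᶜ : Set X) →ₗ[ℝ] KashaevSpace m,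
    ∀ (ω : DualOrientation T.edge) (c : ω.cycles) (i : Fin (3 * m)),
      lnH (ω.start i) (f₃ (T.dualClass ω c)) = -(c : Fin (3 * m) → ℝ) i ∧
      lnH (ω.finish i) (f₃ (T.dualClass ω c)) = (c : Fin (3 * m) → ℝ) i := by
  choose W hW using T.exists_side_functional
  let f₃ : H1 (Pᶜ : Set X) →ₗ[ℝ] KashaevSpace m :=
    -- The sides `2` and `1` carry `-ln y` and `ln z`. The `0`-side is then forced, and takes the
    -- right value because the chain has zero boundary at each triangle.
    LinearMap.pi fun μ => (-W (μ, 2)).prod (W (μ, 1))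
  refine ⟨f₃, fun ω c i => ?_⟩
  have hs : ∀ i, W (ω.start i) (T.dualClass ω c) = -(c : Fin (3 * m) → ℝ) i := fun i => by
    have h := (hW (ω.start i) ω c).1
    rw [ω.edge_start] at h
    exact h rfl
  have hf : ∀ i, W (ω.finish i) (T.dualClass ω c) = (c : Fin (3 * m) → ℝ) i := fun i => by
    have h := (hW (ω.finish i) ω c).2
    rw [ω.edge_finish] at h
    exact h rfl
  have key : ∀ s, lnH s (f₃ (T.dualClass ω c)) = W s (T.dualClass ω c) := by
    rintro ⟨μ, k⟩
    have h := T.boundary_apply ω c (fun s => W s (T.dualClass ω c)) hs hf μ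
    rw [LinearMap.mem_ker.1 c.2, Fin.sum_univ_three, Pi.zero_apply] at h
    fin_cases k
    · simp [lnH, f₃]
      linarith
    · simp [lnH, f₃]
    · simp [lnH, f₃]
  exact ⟨(key _).trans (hs i), (key _).trans (hf i)⟩

/-- The dual graph is connected: a function of the triangles with equal values on adjacent
triangles is constant. -/
theorem eq_of_adjacent [ConnectedSpace X] {Y : Type*} (y : Fin (2 * m) → Y)
    (hy : ∀ s t, T.edge s = T.edge t → y s.1 = y t.1) (μ ν : Fin (2 * m)) : y μ = y ν := by
  -- With the discrete topology on `Y`, the function descends to a continuous map on the connected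
  -- glued space.
  let := (⊥ : TopologicalSpace Y)
  have : DiscreteTopology Y := ⟨rfl⟩
  let F : GluedSpace T.edge → Y := Quot.lift (fun x => y x.1) fun a b ⟨k, l, _, h, _⟩ =>
    hy (a.1, k) (b.1, l) h
  have hF : Continuous F :=
    continuous_quot_lift _ ((continuous_of_discreteTopology (f := y)).comp continuous_fst)
  have := T.homeo.symm.surjective.connectedSpace T.homeo.symm.continuous
  exact PreconnectedSpace.constant inferInstance hF
    (x := GluedSpace.mk T.edge (μ, stdSimplex.vertex 0))
    (y := GluedSpace.mk T.edge (ν, stdSimplex.vertex 0))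

/-- The nontrivial inclusion is by duality: a functional that kills the range of `f₂` must have all
its coefficients equal, so it also kills the kernel of `f₁`. -/
theorem exact_f₂_f₁ [ConnectedSpace X] (hm : 0 < m) : Function.Exact (f₂ T) (f₁ m) := by
  intro w
  refine ⟨fun hw => ?_, ?_⟩
  · change w ∈ (f₂ T).range
    by_contra hne
    obtain ⟨l, hlw, hl⟩ := Submodule.exists_le_ker_of_notMem hne
    obtain ⟨ω⟩ := T.nonempty_dualOrientation
    let y : Fin (3 * m) → ℝ := fun i => l (Pi.single i 1)
    have hly : ∀ u : ShearSpace m, l u = ∑ i, u i * y i := fun u => by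
      conv_lhs => rw [pi_eq_sum_univ' u]
      rw [map_sum]
      exact Finset.sum_congr rfl fun i _ => by rw [map_smul, smul_eq_mul]
    have hsum : ∀ v : KashaevSpace m, ∑ s, lnH s v * y (T.edge s) = 0 := fun v => by
      have h := hl ⟨v, rfl⟩
      rw [LinearMap.mem_ker, hly] at h
      rw [T.sum_sides ω, ← h]
      refine Finset.sum_congr rfl fun i _ => ?_
      rw [ω.edge_start, ω.edge_finish, T.f₂_apply ω, add_mul]
    -- Testing on vectors supported at one triangle; the choices `(1, 0)` and `(0, 1)` of `(a, b)`
    -- then equate the coefficients on its three sides.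
    have htri : ∀ μ (a b : ℝ), (a - b) * y (T.edge (μ, 0)) + b * y (T.edge (μ, 1)) -
        a * y (T.edge (μ, 2)) = 0 := fun μ a b => by
      have h := hsum (Pi.single μ (a, b))
      rw [Fintype.sum_prod_type, Finset.sum_eq_single μ, Fin.sum_univ_three] at h
      · simpa [lnH, sub_eq_add_neg] using h
      · intro ν _ hν
        rw [Fin.sum_univ_three]
        simp [lnH, hν]
      · simp
    have hside : ∀ s, y (T.edge s) = y (T.edge (s.1, 0)) := by
      rintro ⟨μ, k⟩
      have h1 := htri μ 1 0
      have h2 := htri μ 0 1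
      fin_cases k
      · rfl
      · simp only [Fin.mk_one]
        linarith
      · simp only [Fin.reduceFinMk]
        linarith
    have hconst := T.eq_of_adjacent (fun μ => y (T.edge (μ, 0))) fun s t h => by
      rw [← hside s, ← hside t, h]
    have hy : ∀ i, y i = y (T.edge (⟨0, by omega⟩, 0)) := fun i => by
      rw [← ω.edge_start i, hside, hconst _ ⟨0, by omega⟩]
    refine hlw ?_
    rw [hly, Finset.sum_congr rfl fun i _ => by rw [hy i], ← Finset.sum_mul]
    rw [f₁, LinearMap.sum_apply] at hw
    exact mul_eq_zero_of_left hw _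
  · rintro ⟨v, rfl⟩
    exact T.f₁_f₂ v

end DecoratedIdealTriangulation

end Kashaev

end

/-! ### Assembly of the exact sequence -/

open Kashaev in
theorem mainTheorem5 (X : Type) [TopologicalSpace X] [ConnectedSpace X] (P : Set X)
    (m : ℕ) (hm : 0 < m) (T : DecoratedIdealTriangulation X P m) :
    (∀ ω : DualOrientation T.edge, Function.Surjective (T.dualClass ω)) ∧
    ∃ f₃ : H1 (Pᶜ : Set X) →ₗ[ℝ] KashaevSpace m,
      (∀ (ω : DualOrientation T.edge) (c : ω.cycles) (i : Fin (3 * m)),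
        lnH (ω.start i) (f₃ (T.dualClass ω c)) = -(c : Fin (3 * m) → ℝ) i ∧
        lnH (ω.finish i) (f₃ (T.dualClass ω c)) = (c : Fin (3 * m) → ℝ) i) ∧
      Function.Injective f₃ ∧
      Function.Exact f₃ (f₂ T) ∧
      Function.Exact (f₂ T) (f₁ m) ∧
      Function.Surjective (f₁ m) := by
  obtain ⟨f₃, hf₃⟩ := T.exists_f₃
  obtain ⟨ω⟩ := T.nonempty_dualOrientation
  refine ⟨T.surjective_dualClass, f₃, hf₃, ?_, ?_, T.exact_f₂_f₁ hm, ?_⟩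
  · rw [← LinearMap.ker_eq_bot, LinearMap.ker_eq_bot']
    intro h hh
    obtain ⟨c, rfl⟩ := T.surjective_dualClass ω h
    have hc : c = 0 := by
      ext i
      have h1 := (hf₃ ω c i).2
      rw [hh, map_zero] at h1
      exact h1.symm
    rw [hc, map_zero]
  · intro v
    constructor
    · intro hv
      let c : Fin (3 * m) → ℝ := fun i => lnH (ω.finish i) v
      have hs : ∀ i, lnH (ω.start i) v = -c i := fun i => by
        have h := T.f₂_apply ω v i
        rw [hv] at h
        exact eq_neg_of_add_eq_zero_left h.symm
      -- The boundary of `c` at a triangle is the sum of the three numbers on its sides, which is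
      -- zero for any Kashaev coordinates.
      have hc : c ∈ ω.cycles := by
        rw [LinearMap.mem_ker]
        funext μ
        rw [T.boundary_apply ω c (fun s => lnH s v) hs (fun _ => rfl) μ]
        exact sum_lnH μ v
      refine ⟨T.dualClass ω ⟨c, hc⟩, lnH_ext fun s => ?_⟩
      rcases T.eq_start_or_finish ω s with h | h
      · rw [h, (hf₃ ω ⟨c, hc⟩ _).1, hs]
      · rw [h, (hf₃ ω ⟨c, hc⟩ _).2]
    · rintro ⟨h, rfl⟩
      obtain ⟨c, rfl⟩ := T.surjective_dualClass ω h
      funext i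
      rw [T.f₂_apply ω, (hf₃ ω c i).1, (hf₃ ω c i).2]
      simp
  · refine LinearMap.surjective fun h => ?_
    have h1 := LinearMap.congr_fun h (Pi.single ⟨0, by omega⟩ 1)
    simp [f₁] at h1
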